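/- **Theorem 1.18.** Let $(X,\mathcal B,\mu)$ be a $\sigma$-finite measure space without atoms, i.e. every $E\in\mathcal B$ with $\mu(E)>0$ can be partitioned into two measurable subsets of positive measure. Let $1\le p\le\infty$ and $\varphi\in L^\infty(X\times X,\mathcal B\otimes\mathcal B,\mu\otimes\mu)$ (complex valued). Then $$\|\varphi\|_{MS^p(L^2(X))}=\|\varphi\|_{cbMS^p(L^2(X))}\quad\text{in }[0,\infty].$$ Here, for a complex Hilbert space $H$, $S^p(H)$ is the Schatten class: for $p<\infty$, the bounded operators $A$ on $H$ with $\|A\|_p=\operatorname{Tr}(|A|^p)^{1/p}<\infty$; for $p=\infty$, the compact operators with the operator norm. The space $S^2(L^2(X))$ is identified with $L^2(X\times X,\mu\otimes\mu)$ by letting $k$ correspond to the operator $(A_kf)(x)=\int k(x,y)f(y)\,d\mu(y)$. The Schur multiplier with symbol $\varphi$ is the map $M_\varphi:A_k\mapsto A_{\varphi k}$ on $S^2(L^2(X))$. The norm $\|\varphi\|_{MS^p(L^2(X))}$ is the norm of the bounded linear map $S^p(L^2(X))\to S^p(L^2(X))$ that extends the restriction of $M_\varphi$ to $S^2\cap S^p$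 (this extension is unique and is still denoted $M_\varphi$), and it is $\infty$ if there is no such extension. The completely bounded norm $\|\varphi\|_{cbMS^p(L^2(X))}$ is the supremum over all complex Hilbert spaces $K$ of the norm of the bounded linear extension of $M_\varphi\otimes\mathrm{id}$ from $S^p(L^2(X))\otimes S^p(K)$ to $S^p(L^2(X)\otimes_2K)$, and it is $\infty$ if $M_\varphi$, or $M_\varphi\otimes\mathrm{id}$ for some $K$, has no such extension. -/

import Mathlib

open MeasureTheory TensorProduct UniformSpace
open scoped ENNReal NNReal

universe u v

noncomputable section

namespace SchurMultiplier

section Schatten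

variable {H : Type*} [NormedAddCommGroup H] [InnerProductSpace ℂ H] [CompleteSpace H]

/-- An orthonormal basis of the Hilbert space `H`, chosen once and for all. -/
def stdBasisIndex (H : Type*) [NormedAddCommGroup H] [InnerProductSpace ℂ H] [CompleteSpace H] :
    Set H :=
  (exists_hilbertBasis ℂ H).choose

/-- The chosen orthonormal basis, indexed by the set of its vectors. -/
def stdBasis (H : Type*) [NormedAddCommGroup H] [InnerProductSpace ℂ H] [CompleteSpace H] :
    HilbertBasis (stdBasisIndex H) ℂ H :=
  (exists_hilbertBasis ℂ H).choose_spec.choose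

/-- The trace `∑ᵢ ⟨eᵢ, a eᵢ⟩ ∈ [0, ∞]` of a positive operator `a`
(it does not depend on the orthonormal basis `(eᵢ)`). -/
def posTrace (a : H →L[ℂ] H) : ℝ≥0∞ :=
  ∑' i, ENNReal.ofReal (inner ℂ (stdBasis H i) (a (stdBasis H i))).re

/-- `A` belongs to the Schatten class `S^p(H)`: `A` is compact if `p = ∞`, and
`Tr(|A|^p) < ∞` if `p < ∞`, where `|A| = (A* A)^{1/2}`. -/
def MemSchatten (p : ℝ≥0∞) (A : H →L[ℂ] H) : Prop :=
  if p = ∞ then IsCompactOperator A else posTrace (CFC.abs A ^ p.toReal) < ∞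

/-- The norm of `S^p(H)`: the operator norm if `p = ∞`, and `Tr(|A|^p)^{1/p}` if `p < ∞`. -/
def schattenNorm (p : ℝ≥0∞) (A : H →L[ℂ] H) : ℝ≥0∞ :=
  if p = ∞ then ‖A‖ₑ else posTrace (CFC.abs A ^ p.toReal) ^ (1 / p.toReal)

/-- `T` restricts to a bounded linear map `S^p(H) → S^p(H)` of norm at most `C`.
(The values of `T` outside `S^p(H)` play no role.) -/
structure IsBoundedOnSchatten (p : ℝ≥0∞) (C : ℝ≥0) (T : (H →L[ℂ] H) → (H →L[ℂ] H)) : Prop where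
  mapsTo : ∀ A, MemSchatten p A → MemSchatten p (T A)
  map_add : ∀ A B, MemSchatten p A → MemSchatten p B → T (A + B) = T A + T B
  map_smul : ∀ (c : ℂ) A, MemSchatten p A → T (c • A) = c • T A
  bound : ∀ A, MemSchatten p A → schattenNorm p (T A) ≤ C * schattenNorm p A

/-- The Hilbert space tensor product `H ⊗₂ K`. -/
abbrev HilbertTensor (H K : Type*) [NormedAddCommGroup H] [InnerProductSpace ℂ H]
    [NormedAddCommGroup K] [InnerProductSpace ℂ K] :=
  Completion (H ⊗[ℂ] K)

/-- The operator `A ⊗ B` on `H ⊗₂ K`, with `(A ⊗ B)(x ⊗ y) = A x ⊗ B y`. -/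
def tensorOp {K : Type*} [NormedAddCommGroup K] [InnerProductSpace ℂ K]
    (A : H →L[ℂ] H) (B : K →L[ℂ] K) : HilbertTensor H K →L[ℂ] HilbertTensor H K :=
  (TensorProduct.mapL A B).completion

/-- The map `T^{(K)} = T ⊗ id` on `S^p(H) ⊗ S^p(K) ⊆ S^p(H ⊗₂ K)` extends to a bounded linear map
on `S^p(H ⊗₂ K)` of norm at most `C`. -/
def AmplificationBounded (p : ℝ≥0∞) (C : ℝ≥0) (T : (H →L[ℂ] H) → (H →L[ℂ] H))
    (K : Type*) [NormedAddCommGroup K] [InnerProductSpace ℂ K] [CompleteSpace K] : Prop :=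
  ∃ S : (HilbertTensor H K →L[ℂ] HilbertTensor H K) → (HilbertTensor H K →L[ℂ] HilbertTensor H K),
    IsBoundedOnSchatten p C S ∧
      ∀ (A : H →L[ℂ] H) (B : K →L[ℂ] K), MemSchatten p A → MemSchatten p B →
        S (tensorOp A B) = tensorOp (T A) B

end Schatten

section Multiplier

variable {X : Type u} [MeasurableSpace X]

/-- The measure `μ` has no atom: every measurable set of positive measure is the union of two
disjoint measurable subsets of positive measure. -/
def Atomless (μ : Measure X) : Prop :=
  ∀ s, MeasurableSet s → μ s ≠ 0 → ∃ t ⊆ s, MeasurableSet t ∧ μ t ≠ 0 ∧ μ (s \ t) ≠ 0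

/-- Under the identification `S²(L²(X, μ)) = L²(X × X, μ ⊗ μ)`, the operator `A` corresponds to
the function `k`: `(A f)(x) = ∫ k(x, y) f(y) dμ(y)` for all `f ∈ L²(X, μ)`. -/
def HasKernel (μ : Measure X) (A : Lp ℂ 2 μ →L[ℂ] Lp ℂ 2 μ) (k : X × X → ℂ) : Prop :=
  MemLp k 2 (μ.prod μ) ∧ ∀ f : Lp ℂ 2 μ, A f =ᵐ[μ] fun x => ∫ y, k (x, y) * f y ∂μ

/-- `T` extends to `S^p(L²(X, μ))` the Schur multiplier with symbol `φ`: whenever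
`A ∈ S² ∩ S^p` has kernel `k` and `B ∈ S²` has kernel `φ k`, then `T A = B`. -/
def ExtendsSchur (μ : Measure X) (p : ℝ≥0∞) (φ : X × X → ℂ)
    (T : (Lp ℂ 2 μ →L[ℂ] Lp ℂ 2 μ) → (Lp ℂ 2 μ →L[ℂ] Lp ℂ 2 μ)) : Prop :=
  ∀ (A B : Lp ℂ 2 μ →L[ℂ] Lp ℂ 2 μ) (k : X × X → ℂ),
    MemSchatten 2 A → MemSchatten p A → HasKernel μ A k → HasKernel μ B (fun z => φ z * k z) →
      T A = B

/-- The norm `‖φ‖_{MS^p(L²(X, μ))} ∈ [0, ∞]` of the Schur multiplier with symbol `φ`, equal to `∞`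
if the multiplier does not extend to a bounded linear map on `S^p`. -/
def schurNorm (μ : Measure X) (p : ℝ≥0∞) (φ : X × X → ℂ) : ℝ≥0∞ :=
  ⨅ (C : ℝ≥0) (_ : ∃ T, ExtendsSchur μ p φ T ∧ IsBoundedOnSchatten p C T), (C : ℝ≥0∞)

/-- The completely bounded norm `‖φ‖_{cbMS^p(L²(X, μ))} ∈ [0, ∞]` of the Schur multiplier with
symbol `φ`: the supremum over all Hilbert spaces `K` (in an arbitrary universe) of the norm of
`M_φ ⊗ id` on `S^p(L²(X, μ) ⊗₂ K)`, equal to `∞` if the multiplier does not extend to a completely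
bounded map on `S^p`. -/
def schurCbNorm (μ : Measure X) (p : ℝ≥0∞) (φ : X × X → ℂ) : ℝ≥0∞ :=
  ⨅ (C : ℝ≥0)
    (_ : ∃ T, ExtendsSchur μ p φ T ∧ (∃ C' : ℝ≥0, IsBoundedOnSchatten p C' T) ∧
      ∀ (K : Type v) [NormedAddCommGroup K] [InnerProductSpace ℂ K] [CompleteSpace K],
        AmplificationBounded p C T K), (C : ℝ≥0∞)

end Multiplier

end SchurMultiplier

end

/-
The point is to bound `M_φ ⊗ id` by the norm of `M_φ`, one finite set `F` of coordinates of `K` at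
a time: on `H ⊗ ℓ²(F)`, with `H = L²(X)`, it acts on operator matrices block by block. Since `μ` has
no atoms, there are functions `r n` with values `±1` such that the multiplication operators by
`r m` and `r n`, for `m ≠ n`, move finitely many given vectors to almost orthogonal ones. For any
Schur multiplier `M_φ (r_i A r_j) = r_i M_φ(A) r_j`, so the map `V (x_i)_i = ∑ r_i x_i` from
`H ⊗ ℓ²(F)` to `H`, which is almost isometric on a given finite dimensional subspace, satisfies
`M_φ (V Z V*) = V ((M_φ ⊗ id) Z) V*`. Compressing `Z` and its image to such a subspace gives
`‖(M_φ ⊗ id) Z‖_p ≤ C ‖Z‖_p`, and this bound survives the limit over `F`. The converse inequality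
comes from tensoring with a rank one projection.

The facts needed about `S^p`, `p < ∞`, come from the variational formula
`‖A‖_p^p = sup ∑ |⟨ξ_i, A η_i⟩|^p`, where `ξ` and `η` run over the finite families which satisfy
Bessel's inequality. Such families are preserved by contractions, which orthonormal ones are not.
-/

noncomputable section

namespace SchurMultiplier

open Filter Topology InnerProductSpace
open ContinuousLinearMap (adjoint)

section Bessel

variable {H : Type*} [NormedAddCommGroup H] [InnerProductSpace ℂ H]
variable {H' : Type*} [NormedAddCommGroup H'] [InnerProductSpace ℂ H']

/-- A finite family satisfying Bessel's inequality with constant `1`. Unlike orthonormal families,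
such families are stable under contractions. -/
def IsBessel {ι : Type*} [Fintype ι] (e : ι → H) : Prop :=
  ∀ x : H, ∑ i, ‖inner ℂ (e i) x‖ ^ 2 ≤ ‖x‖ ^ 2

variable {ι ι' : Type*} [Fintype ι] [Fintype ι']

lemma isBessel_of_orthonormal {e : ι → H} (he : Orthonormal ℂ e) : IsBessel e :=
  fun x => he.sum_inner_products_le x

lemma isBessel_singleton {x : H} (hx : ‖x‖ ≤ 1) : IsBessel (fun _ : Fin 1 => x) := fun y => by
  simp only [Finset.univ_unique, Finset.sum_const, Finset.card_singleton, one_smul]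
  gcongr
  exact (norm_inner_le_norm _ _).trans (mul_le_of_le_one_left (norm_nonneg _) hx)

lemma IsBessel.norm_le_one {e : ι → H} (he : IsBessel e) (i : ι) : ‖e i‖ ≤ 1 := by
  have h : ‖inner ℂ (e i) (e i)‖ ^ 2 ≤ ‖e i‖ ^ 2 :=
    (Finset.single_le_sum (f := fun j => ‖inner ℂ (e j) (e i)‖ ^ 2)
      (fun _ _ => sq_nonneg _) (Finset.mem_univ i)).trans (he (e i))
  rw [inner_self_eq_norm_sq_to_K, norm_pow, RCLike.norm_ofReal, abs_norm] at h
  by_contra! hlt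
  nlinarith [one_lt_pow₀ hlt two_ne_zero]

lemma IsBessel.map [CompleteSpace H] [CompleteSpace H'] {e : ι → H} (he : IsBessel e)
    {V : H →L[ℂ] H'} (hV : ‖V‖ ≤ 1) : IsBessel (fun i => V (e i)) := fun x => by
  simp_rw [← ContinuousLinearMap.adjoint_inner_right]
  refine (he _).trans ?_
  gcongr
  refine (ContinuousLinearMap.le_opNorm _ _).trans ?_
  rw [LinearIsometryEquiv.norm_map]
  exact mul_le_of_le_one_left (norm_nonneg _) hV

lemma IsBessel.reindex (φ : ι' ≃ ι) {e : ι → H} (he : IsBessel e) :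
    IsBessel (fun i => e (φ i)) := fun x =>
  (φ.sum_comp fun i => ‖inner ℂ (e i) x‖ ^ 2).trans_le (he x)

lemma IsBessel.sumElim_orthogonal {e : ι → H} {f : ι' → H} (he : IsBessel e) (hf : IsBessel f)
    (E : Submodule ℂ H) [E.HasOrthogonalProjection] (heE : ∀ i, e i ∈ E) :
    IsBessel (Sum.elim e fun j => Eᗮ.starProjection (f j)) := fun x => by
  have he' : ∀ i, inner ℂ (e i) x = inner ℂ (e i) (E.starProjection x) := fun i => by
    rw [← Submodule.inner_starProjection_left_eq_right,
      Submodule.starProjection_eq_self_iff.mpr (heE i)]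
  rw [Fintype.sum_sum_type, E.norm_sq_eq_add_norm_sq_starProjection x]
  simp only [Sum.elim_inl, Sum.elim_inr, he', Submodule.inner_starProjection_left_eq_right]
  exact add_le_add (he _) (hf _)

lemma ofReal_norm_sq_eq_tsum {κ : Type*} (f : HilbertBasis κ ℂ H) (x : H) :
    ENNReal.ofReal (‖x‖ ^ 2) = ∑' j, ENNReal.ofReal (‖inner ℂ (f j) x‖ ^ 2) := by
  have h : HasSum (fun j => ‖inner ℂ (f j) x‖ ^ 2) (‖x‖ ^ 2) := by
    convert Complex.hasSum_re (f.hasSum_inner_mul_inner x x) using 1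
    · ext j
      rw [← inner_conj_symm x, RCLike.conj_mul]
      norm_cast
    · rw [inner_self_eq_norm_sq_to_K]
      norm_cast
  rw [← h.tsum_eq, ENNReal.ofReal_tsum_of_nonneg (fun _ => sq_nonneg _) h.summable]

lemma IsBessel.sum_norm_sq_le_tsum [CompleteSpace H] {κ : Type*} (f : HilbertBasis κ ℂ H)
    {e : ι → H} (he : IsBessel e) {b : H →L[ℂ] H} (hb : IsSelfAdjoint b) :
    ∑ i, ENNReal.ofReal (‖b (e i)‖ ^ 2) ≤ ∑' j, ENNReal.ofReal (‖b (f j)‖ ^ 2) := by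
  simp_rw [ofReal_norm_sq_eq_tsum f (b (e _))]
  rw [← Summable.tsum_finsetSum fun _ _ => ENNReal.summable]
  refine ENNReal.tsum_le_tsum fun j => ?_
  rw [← ENNReal.ofReal_sum_of_nonneg fun _ _ => sq_nonneg _]
  refine ENNReal.ofReal_le_ofReal (le_trans (le_of_eq ?_) (he (b (f j))))
  refine Finset.sum_congr rfl fun i _ => ?_
  rw [← ContinuousLinearMap.adjoint_inner_left,
    ContinuousLinearMap.isSelfAdjoint_iff'.mp hb, norm_inner_symm]

end Bessel

section FunctionalCalculus

variable {H : Type*} [NormedAddCommGroup H] [InnerProductSpace ℂ H] [CompleteSpace H]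
variable {a : H →L[ℂ] H} {p : ℝ}

lemma re_inner_cfc_mono {f g : ℝ → ℝ} (h : ∀ t ∈ spectrum ℝ a, f t ≤ g t) (x : H)
    (hf : Continuous f) (hg : Continuous g) :
    (inner ℂ x (cfc f a x)).re ≤ (inner ℂ x (cfc g a x)).re := by
  have hle := cfc_mono (a := a) h hf.continuousOn hg.continuousOn
  rw [ContinuousLinearMap.le_def] at hle
  have := hle.re_inner_nonneg_right x
  rw [sub_apply, inner_sub_right, map_sub] at this
  exact sub_nonneg.mp this

lemma norm_cfc_apply_sq {f : ℝ → ℝ} (x : H) (hf : Continuous f) :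
    ‖cfc f a x‖ ^ 2 = (inner ℂ x (cfc (fun t => f t ^ 2) a x)).re := by
  simp_rw [pow_two (f _)]
  rw [ContinuousLinearMap.apply_norm_sq_eq_inner_adjoint_right,
    ContinuousLinearMap.isSelfAdjoint_iff'.mp (IsSelfAdjoint.cfc (f := f) (a := a)),
    cfc_mul f f a hf.continuousOn hf.continuousOn]
  rfl

lemma re_inner_cfc_affine (ha : IsSelfAdjoint a) (c d : ℝ) (x : H) :
    (inner ℂ x (cfc (fun t : ℝ => c + d * t) a x)).re =
      c * ‖x‖ ^ 2 + d * (inner ℂ x (a x)).re := by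
  rw [cfc_const_add c (fun t : ℝ => d * t) a (by fun_prop) ha, cfc_const_mul d (fun t => t) a,
    cfc_id' ℝ a, norm_sq_eq_re_inner (𝕜 := ℂ) x]
  simp [Algebra.algebraMap_eq_smul_one, inner_smul_right_eq_smul]

omit [CompleteSpace H] in
lemma aeval_apply_of_eigenvector {x : H} {l : ℝ} (hx : a x = (l : ℂ) • x) (q : Polynomial ℝ) :
    Polynomial.aeval a q x = ((q.eval l : ℝ) : ℂ) • x := by
  induction q using Polynomial.induction_on with
  | C r => simp [Algebra.algebraMap_eq_smul_one]
  | add q r hq hr => simp [hq, hr, add_smul]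
  | monomial n r ih =>
    rw [pow_succ, ← mul_assoc, map_mul, mul_apply_eq_comp, Polynomial.aeval_X, hx, map_smul, ih,
      smul_smul]
    congr 1
    simp only [Polynomial.eval_mul, Polynomial.eval_C, Polynomial.eval_pow, Polynomial.eval_X]
    push_cast
    ring

lemma cfc_apply_of_eigenvector (ha : IsSelfAdjoint a) {x : H} {l : ℝ} (hx : a x = (l : ℂ) • x)
    {f : ℝ → ℝ} (hf : Continuous f) : cfc f a x = (f l : ℂ) • x := by
  obtain ⟨M, hM⟩ := (ContinuousFunctionalCalculus.isCompact_spectrum (R := ℝ) a).isBounded.union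
    (Bornology.isBounded_singleton (x := l)) |>.exists_norm_le
  rw [← sub_eq_zero, ← norm_le_zero_iff]
  refine le_of_forall_pos_le_add fun ε hε => ?_
  set δ := ε / (2 * (‖x‖ + 1)) with hδ_def
  have hδ : 0 < δ := by positivity
  obtain ⟨q, hq⟩ := exists_polynomial_near_of_continuousOn (-M) M f hf.continuousOn δ hδ
  have hmem : ∀ t ∈ spectrum ℝ a ∪ {l}, |q.eval t - f t| < δ := fun t ht =>
    hq t (abs_le.mp (hM t ht))
  have hcfc : ‖cfc f a - Polynomial.aeval a q‖ ≤ δ := by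
    rw [← cfc_polynomial q a ha, ← cfc_sub f q.eval a]
    refine norm_cfc_le hδ.le fun t ht => ?_
    rw [Real.norm_eq_abs, abs_sub_comm]
    exact (hmem t (Or.inl ht)).le
  have hval : ‖((q.eval l - f l : ℝ) : ℂ)‖ ≤ δ := by
    rw [Complex.norm_real]
    exact (hmem l (Or.inr rfl)).le
  calc ‖cfc f a x - (f l : ℂ) • x‖
      = ‖(cfc f a - Polynomial.aeval a q) x + ((q.eval l - f l : ℝ) : ℂ) • x‖ := by
        rw [sub_apply, aeval_apply_of_eigenvector hx]
        push_cast
        congr 1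
        module
    _ ≤ δ * ‖x‖ + δ * ‖x‖ := by
        refine (norm_add_le _ _).trans
          (add_le_add (ContinuousLinearMap.le_of_opNorm_le _ hcfc x) ?_)
        rw [norm_smul]
        gcongr
    _ ≤ 0 + ε := by
        rw [hδ_def, zero_add, ← two_mul, div_mul_eq_mul_div, mul_div_assoc',
          div_le_iff₀ (by positivity)]
        nlinarith [norm_nonneg x]

lemma tangent_le_rpow {s t : ℝ} (hp : 1 ≤ p) (hs : 0 ≤ s) (ht : 0 ≤ t) :
    s ^ p + p * s ^ (p - 1) * (t - s) ≤ t ^ p := by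
  rcases hs.eq_or_lt with rfl | hs
  · rcases hp.eq_or_lt with rfl | hp
    · simp
    · rw [Real.zero_rpow (by linarith), Real.zero_rpow (by linarith)]
      simpa using Real.rpow_nonneg ht p
  · have h := one_add_mul_self_le_rpow_one_add (s := t / s - 1)
      (by have := div_nonneg ht hs.le; linarith) hp
    rw [add_sub_cancel, Real.div_rpow ht hs.le, le_div_iff₀ (Real.rpow_pos_of_pos hs p)] at h
    calc s ^ p + p * s ^ (p - 1) * (t - s) = (1 + p * (t / s - 1)) * s ^ p := by
          rw [Real.rpow_sub_one hs.ne']; field_simp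
      _ ≤ t ^ p := h

lemma rpow_half_sq {t : ℝ} (ht : 0 ≤ t) : (t ^ (p / 2)) ^ 2 = t ^ p := by
  rw [← Real.rpow_natCast, ← Real.rpow_mul ht]; norm_num

lemma rpow_sub_one_mul_self {s : ℝ} (hs : 0 ≤ s) (hp : p ≠ 0) : s ^ (p - 1) * s = s ^ p := by
  rw [← Real.rpow_add_one' hs (by simpa), sub_add_cancel]

lemma norm_cfc_rpow_half_sq (ha : 0 ≤ a) (hp : 0 ≤ p) (x : H) :
    ‖cfc (fun t : ℝ => t ^ (p / 2)) a x‖ ^ 2 = (inner ℂ x (cfc (fun t : ℝ => t ^ p) a x)).re := by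
  rw [norm_cfc_apply_sq x (Real.continuous_rpow_const (by linarith))]
  congr 3
  exact cfc_congr fun t ht => rpow_half_sq (spectrum_nonneg_of_nonneg ha ht)

lemma posTrace_rpow (ha : 0 ≤ a) (hp : 0 ≤ p) :
    posTrace (a ^ p) =
      ∑' i, ENNReal.ofReal (‖cfc (fun t : ℝ => t ^ (p / 2)) a (stdBasis H i)‖ ^ 2) := by
  simp_rw [norm_cfc_rpow_half_sq ha hp, posTrace, CFC.rpow_eq_cfc_real (a := a) ha]

omit [CompleteSpace H] in
lemma re_inner_nonneg_of_nonneg (ha : 0 ≤ a) (x : H) : 0 ≤ (inner ℂ x (a x)).re :=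
  ((ContinuousLinearMap.nonneg_iff_isPositive a).mp ha).re_inner_nonneg_right x

/-- Jensen's inequality for the spectral measure of `a` at `x`. -/
lemma re_inner_rpow_le (ha : 0 ≤ a) (hp : 1 ≤ p) {x : H} (hx : ‖x‖ ≤ 1) :
    (inner ℂ x (a x)).re ^ p ≤ ‖cfc (fun t : ℝ => t ^ (p / 2)) a x‖ ^ 2 := by
  rw [norm_cfc_rpow_half_sq ha (by linarith)]
  set s := (inner ℂ x (a x)).re with hs
  have hs0 : 0 ≤ s := re_inner_nonneg_of_nonneg ha x
  have h := re_inner_cfc_mono (a := a) (x := x)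
    (f := fun t => (s ^ p - p * s ^ (p - 1) * s) + p * s ^ (p - 1) * t) (g := fun t => t ^ p)
    (fun t ht => by
      have := tangent_le_rpow hp hs0 (spectrum_nonneg_of_nonneg ha ht)
      linarith) (by fun_prop) (Real.continuous_rpow_const (by linarith))
  rw [re_inner_cfc_affine (IsSelfAdjoint.of_nonneg ha), ← hs] at h
  refine le_trans ?_ h
  have hn : 0 ≤ 1 - ‖x‖ ^ 2 := by nlinarith [norm_nonneg x]
  have : 0 ≤ (p - 1) * s ^ p * (1 - ‖x‖ ^ 2) :=
    mul_nonneg (mul_nonneg (by linarith) (Real.rpow_nonneg hs0 _)) hn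
  rw [mul_assoc p, rpow_sub_one_mul_self hs0 (by linarith)]
  nlinarith

lemma IsBessel.sum_re_inner_rpow_le {ι : Type*} [Fintype ι] (ha : 0 ≤ a) (hp : 1 ≤ p)
    {e : ι → H} (he : IsBessel e) :
    ∑ i, ENNReal.ofReal ((inner ℂ (e i) (a (e i))).re ^ p) ≤ posTrace (a ^ p) := by
  rw [posTrace_rpow ha (by linarith)]
  exact (Finset.sum_le_sum fun i _ => ENNReal.ofReal_le_ofReal
    (re_inner_rpow_le ha hp (he.norm_le_one i))).trans
    (he.sum_norm_sq_le_tsum (stdBasis H) IsSelfAdjoint.cfc)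

end FunctionalCalculus

section Polar

variable {H : Type*} [NormedAddCommGroup H] [InnerProductSpace ℂ H] [CompleteSpace H]

lemma norm_abs_apply (A : H →L[ℂ] H) (x : H) : ‖CFC.abs A x‖ = ‖A x‖ := by
  have habs : adjoint (CFC.abs A) ∘L CFC.abs A = adjoint A ∘L A := by
    rw [ContinuousLinearMap.isSelfAdjoint_iff'.mp (IsSelfAdjoint.of_nonneg (CFC.abs_nonneg A))]
    exact CFC.abs_mul_abs A
  rw [ContinuousLinearMap.apply_norm_eq_sqrt_inner_adjoint_right, habs,
    ← ContinuousLinearMap.apply_norm_eq_sqrt_inner_adjoint_right]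

lemma norm_mul_eq_norm_abs_mul (A B : H →L[ℂ] H) : ‖A * B‖ = ‖CFC.abs A * B‖ := by
  refine le_antisymm ?_ ?_ <;>
  · refine ContinuousLinearMap.opNorm_le_bound _ (norm_nonneg _) fun x => ?_
    refine le_trans (le_of_eq ?_) (ContinuousLinearMap.le_opNorm _ _)
    simp only [mul_apply_eq_comp, norm_abs_apply]

/-- The function `t ↦ (max t 0 + ε)⁻¹`: for `a ≥ 0` its value at `a` is a regularized inverse
of `a`, continuous on all of `ℝ`. -/
def regInv (ε t : ℝ) : ℝ := (max t 0 + ε)⁻¹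

lemma continuous_regInv {ε : ℝ} (hε : 0 < ε) : Continuous (regInv ε) :=
  Continuous.inv₀ (by fun_prop) fun t => (by positivity : 0 < max t 0 + ε).ne'

lemma mul_cfc_regInv {a : H →L[ℂ] H} (ha : 0 ≤ a) {ε : ℝ} (hε : 0 < ε) :
    a * cfc (regInv ε) a = cfc (fun t => t * regInv ε t) a := by
  have hg := continuous_regInv hε
  rw [cfc_mul (fun t => t) (regInv ε) a (by fun_prop) hg.continuousOn,
    cfc_id' ℝ a (IsSelfAdjoint.of_nonneg ha)]

lemma norm_mul_cfc_regInv_le {a : H →L[ℂ] H} (ha : 0 ≤ a) {ε : ℝ} (hε : 0 < ε) :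
    ‖a * cfc (regInv ε) a‖ ≤ 1 := by
  rw [mul_cfc_regInv ha hε]
  refine norm_cfc_le zero_le_one fun t ht => ?_
  have ht0 : 0 ≤ t := spectrum_nonneg_of_nonneg ha ht
  rw [regInv, max_eq_left ht0, Real.norm_of_nonneg (by positivity), ← div_eq_mul_inv,
    div_le_one (by positivity)]
  linarith

lemma norm_sub_mul_mul_cfc_regInv_le {a : H →L[ℂ] H} (ha : 0 ≤ a) {ε : ℝ} (hε : 0 < ε) :
    ‖a - a * (a * cfc (regInv ε) a)‖ ≤ ε := by
  have hg := continuous_regInv hε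
  have hsub : a - a * (a * cfc (regInv ε) a) = cfc (fun t => t - t * (t * regInv ε t)) a := by
    rw [cfc_sub (fun t => t) (fun t => t * (t * regInv ε t)) a (by fun_prop)
      (by fun_prop), cfc_mul (fun t => t) (fun t => t * regInv ε t) a (by fun_prop)
      (by fun_prop), cfc_id' ℝ a (IsSelfAdjoint.of_nonneg ha), mul_cfc_regInv ha hε]
  rw [hsub]
  refine norm_cfc_le hε.le fun t ht => ?_
  have ht0 : 0 ≤ t := spectrum_nonneg_of_nonneg ha ht
  have hval : t - t * (t * regInv ε t) = t * ε / (t + ε) := by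
    simp only [regInv, max_eq_left ht0]
    field_simp
    ring
  rw [hval, Real.norm_of_nonneg (by positivity), div_le_iff₀ (by positivity)]
  nlinarith

/-- An approximate polar decomposition, with `U = A (|A| + ε)⁻¹`. -/
lemma exists_approx_polar (A : H →L[ℂ] H) {ε : ℝ} (hε : 0 < ε) :
    ∃ U : H →L[ℂ] H, ‖U‖ ≤ 1 ∧ ‖A - U * CFC.abs A‖ ≤ ε ∧ ‖CFC.abs A - star U * A‖ ≤ ε := by
  have ha : 0 ≤ CFC.abs A := CFC.abs_nonneg A
  set a := CFC.abs A with ha_def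
  set r := cfc (regInv ε) a
  have hcomm : r * a = a * r := by
    simpa only [cfc_id' ℝ a (IsSelfAdjoint.of_nonneg ha)] using
      (cfc_commute_cfc (regInv ε) (fun t => t) a).eq
  refine ⟨A * r, ?_, ?_, ?_⟩
  · rw [norm_mul_eq_norm_abs_mul]
    exact norm_mul_cfc_regInv_le ha hε
  · rw [show A - A * r * a = A * (1 - a * r) by rw [mul_assoc, hcomm, mul_sub, mul_one],
      norm_mul_eq_norm_abs_mul, mul_sub, mul_one]
    exact norm_sub_mul_mul_cfc_regInv_le ha hε
  · have : star (A * r) * A = a * (a * r) := by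
      rw [star_mul, mul_assoc, ← CFC.abs_mul_abs A, ← ha_def, (IsSelfAdjoint.cfc).star_eq,
        ← mul_assoc, hcomm, mul_assoc, hcomm]
    rw [this]
    exact norm_sub_mul_mul_cfc_regInv_le ha hε

end Polar

section FiniteRank

variable {H : Type*} [NormedAddCommGroup H] [InnerProductSpace ℂ H]

/-- The space of finite rank operators, as the span of the rank one operators. -/
def finiteRank (H : Type*) [NormedAddCommGroup H] [InnerProductSpace ℂ H] :
    Submodule ℂ (H →L[ℂ] H) :=
  Submodule.span ℂ (Set.range fun ξη : H × H => rankOne ℂ ξη.1 ξη.2)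

lemma rankOne_mem_finiteRank (ξ η : H) : rankOne ℂ ξ η ∈ finiteRank H :=
  Submodule.subset_span ⟨(ξ, η), rfl⟩

lemma isCompactOperator_rankOne (ξ η : H) : IsCompactOperator (rankOne ℂ ξ η) := by
  rw [rankOne_def']
  exact ((isCompactOperator_id (E := ℂ)).comp_clm (innerSL ℂ η)).clm_comp
    (ContinuousLinearMap.toSpanSingleton ℂ ξ)

lemma isCompactOperator_of_mem_finiteRank {A : H →L[ℂ] H} (hA : A ∈ finiteRank H) :
    IsCompactOperator A := by
  induction hA using Submodule.span_induction with
  | mem A h => obtain ⟨ξη, rfl⟩ := h; exact isCompactOperator_rankOne _ _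
  | zero => exact isCompactOperator_zero
  | add A B _ _ hA hB => exact hA.add hB
  | smul c A _ hA => exact hA.smul c

lemma mem_finiteRank_of_finiteDimensional_range [CompleteSpace H] {A : H →L[ℂ] H}
    (h : FiniteDimensional ℂ A.range) : A ∈ finiteRank H := by
  let u := stdOrthonormalBasis ℂ A.range
  have hA : A = ∑ i, rankOne ℂ (u i : H) (adjoint A (u i)) := by
    ext x
    have hx := congrArg Subtype.val (u.sum_repr' ⟨A x, ⟨x, rfl⟩⟩)
    simp only [Submodule.coe_sum, Submodule.coe_smul, Submodule.coe_inner] at hx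
    simp only [sum_apply, rankOne_apply, ContinuousLinearMap.adjoint_inner_left]
    exact hx.symm
  rw [hA]
  exact Submodule.sum_mem _ fun i _ => rankOne_mem_finiteRank _ _

lemma sub_compression_mem_finiteRank [CompleteSpace H] (A : H →L[ℂ] H) (E F : Submodule ℂ H)
    [FiniteDimensional ℂ E] [FiniteDimensional ℂ F] :
    A - Fᗮ.starProjection ∘L A ∘L Eᗮ.starProjection ∈ finiteRank H := by
  refine mem_finiteRank_of_finiteDimensional_range
    (Submodule.finiteDimensional_of_le (S₂ := F ⊔ E.map (A : H →ₗ[ℂ] H)) ?_)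
  rintro _ ⟨x, rfl⟩
  have hx : (A - Fᗮ.starProjection ∘L A ∘L Eᗮ.starProjection) x =
      F.starProjection (A (Eᗮ.starProjection x)) + A (E.starProjection x) := by
    simp only [Submodule.starProjection_orthogonal', sub_apply, ContinuousLinearMap.comp_apply,
      one_apply_eq_self, map_sub]
    abel
  rw [ContinuousLinearMap.coe_coe, hx]
  exact Submodule.add_mem_sup (Submodule.starProjection_apply_mem _ _)
    ⟨_, Submodule.starProjection_apply_mem _ _, rfl⟩

end FiniteRank

section BesselBound

variable {E : Type*} [NormedAddCommGroup E] [NormedSpace ℂ E]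
variable {H : Type*} [NormedAddCommGroup H] [InnerProductSpace ℂ H]
variable {H' : Type*} [NormedAddCommGroup H'] [InnerProductSpace ℂ H']

/-- The variational form of the inequality `‖A‖_p ≤ c` for `p < ∞`, by testing on pairs of finite
Bessel families; see `schattenNorm_le_ofReal_iff`. -/
def BesselBound (p : ℝ) (A : H →L[ℂ] H) (c : ℝ) : Prop :=
  ∀ (n : ℕ) (e f : Fin n → H), IsBessel e → IsBessel f →
    ∑ i, ‖inner ℂ (f i) (A (e i))‖ ^ p ≤ c ^ p

variable {p c d : ℝ} {A B : H →L[ℂ] H}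

lemma BesselBound.sum_le (h : BesselBound p A c) {ι : Type*} [Fintype ι]
    {e f : ι → H} (he : IsBessel e) (hf : IsBessel f) :
    ∑ i, ‖inner ℂ (f i) (A (e i))‖ ^ p ≤ c ^ p := by
  have := h _ _ _ (he.reindex (Fintype.equivFin ι).symm) (hf.reindex (Fintype.equivFin ι).symm)
  rwa [Equiv.sum_comp (Fintype.equivFin ι).symm fun i => ‖inner ℂ (f i) (A (e i))‖ ^ p] at this

lemma BesselBound.add (hp : 1 ≤ p) (hc : 0 ≤ c) (hd : 0 ≤ d)
    (hA : BesselBound p A c) (hB : BesselBound p B d) : BesselBound p (A + B) (c + d) := by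
  intro n e f he hf
  have hp0 : 0 < p := by linarith
  have minkowski := Real.Lp_add_le_of_nonneg (s := Finset.univ)
    (f := fun i => ‖inner ℂ (f i) (A (e i))‖) (g := fun i => ‖inner ℂ (f i) (B (e i))‖) hp
    (fun _ _ => norm_nonneg _) (fun _ _ => norm_nonneg _)
  have hA' : (∑ i, ‖inner ℂ (f i) (A (e i))‖ ^ p) ^ (1 / p) ≤ c := by
    rw [one_div, Real.rpow_inv_le_iff_of_pos (by positivity) hc hp0]
    exact hA n e f he hf
  have hB' : (∑ i, ‖inner ℂ (f i) (B (e i))‖ ^ p) ^ (1 / p) ≤ d := by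
    rw [one_div, Real.rpow_inv_le_iff_of_pos (by positivity) hd hp0]
    exact hB n e f he hf
  have hsum := minkowski.trans (add_le_add hA' hB')
  rw [one_div, Real.rpow_inv_le_iff_of_pos (by positivity) (by positivity) hp0] at hsum
  refine le_trans (Finset.sum_le_sum fun i _ => ?_) hsum
  refine Real.rpow_le_rpow (norm_nonneg _) ?_ hp0.le
  rw [add_apply, inner_add_right]
  exact norm_add_le _ _

lemma exists_norm_le_one_smul_eq (x : E) : ∃ u : E, ‖u‖ ≤ 1 ∧ x = (‖x‖ : ℂ) • u := by
  rcases eq_or_ne x 0 with rfl | hx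
  · exact ⟨0, by simp⟩
  · have hx' : (‖x‖ : ℂ) ≠ 0 := by exact_mod_cast norm_ne_zero_iff.mpr hx
    refine ⟨(‖x‖ : ℂ)⁻¹ • x, ?_, (smul_inv_smul₀ hx' x).symm⟩
    rw [norm_smul, norm_inv, Complex.norm_of_nonneg (norm_nonneg x),
      inv_mul_cancel₀ (norm_ne_zero_iff.mpr hx)]

lemma BesselBound.conj [CompleteSpace H] [CompleteSpace H'] (hc : 0 ≤ c) (hA : BesselBound p A c)
    (V : H →L[ℂ] H') (W : H' →L[ℂ] H) : BesselBound p (V ∘L A ∘L W) (‖V‖ * c * ‖W‖) := by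
  intro n e f he hf
  obtain ⟨v, hv, hVv⟩ := exists_norm_le_one_smul_eq (adjoint V)
  obtain ⟨w, hw, hWw⟩ := exists_norm_le_one_smul_eq W
  rw [LinearIsometryEquiv.norm_map] at hVv
  have hterm : ∀ i, ‖inner ℂ (f i) ((V ∘L A ∘L W) (e i))‖ ^ p =
      (‖V‖ * ‖W‖) ^ p * ‖inner ℂ (v (f i)) (A (w (e i)))‖ ^ p := fun i => by
    have hV := congrArg (· (f i)) hVv
    have hW := congrArg (· (e i)) hWw
    simp only [smul_apply] at hV hW
    rw [← Real.mul_rpow (by positivity) (norm_nonneg _), ContinuousLinearMap.comp_apply,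
      ContinuousLinearMap.comp_apply, ← ContinuousLinearMap.adjoint_inner_left, hV, hW, map_smul,
      inner_smul_left, inner_smul_right, norm_mul, norm_mul, RCLike.norm_conj,
      Complex.norm_of_nonneg (norm_nonneg _), Complex.norm_of_nonneg (norm_nonneg _), mul_assoc]
  calc ∑ i, ‖inner ℂ (f i) ((V ∘L A ∘L W) (e i))‖ ^ p
      = (‖V‖ * ‖W‖) ^ p * ∑ i, ‖inner ℂ (v (f i)) (A (w (e i)))‖ ^ p := by
        simp_rw [hterm, Finset.mul_sum]
    _ ≤ (‖V‖ * ‖W‖) ^ p * c ^ p := by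
        gcongr
        exact hA n _ _ (he.map hw) (hf.map hv)
    _ = (‖V‖ * c * ‖W‖) ^ p := by
        rw [← Real.mul_rpow (by positivity) hc, mul_right_comm]

lemma BesselBound.of_tendsto (hp : 0 ≤ p) {α : Type*} {l : Filter α} [l.NeBot]
    {B : α → H →L[ℂ] H} (hB : ∀ᶠ k in l, BesselBound p (B k) c) (h : Tendsto B l (𝓝 A)) :
    BesselBound p A c := by
  intro n e f he hf
  have hinner : ∀ x y : H, Tendsto (fun k => inner ℂ x (B k y)) l (𝓝 (inner ℂ x (A y))) :=
    fun x y =>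
      ((continuous_const.inner ((ContinuousLinearMap.apply ℂ H y).continuous)).tendsto A).comp h
  exact le_of_tendsto (tendsto_finsetSum _ fun i _ => (hinner _ _).norm.rpow_const (Or.inr hp))
    (hB.mono fun k hk => hk n e f he hf)

omit [NormedSpace ℂ E] in
lemma tendsto_of_norm_sub_le_one_div {A : E} {B : ℕ → E}
    (hB : ∀ n : ℕ, ‖A - B n‖ ≤ 1 / ((n : ℝ) + 1)) : Tendsto B atTop (𝓝 A) := by
  rw [tendsto_iff_norm_sub_tendsto_zero]
  refine squeeze_zero (fun _ => norm_nonneg _) (fun n => ?_) tendsto_one_div_add_atTop_nhds_zero_nat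
  rw [norm_sub_rev]
  exact hB n

lemma BesselBound.of_norm_sub_le (hp : 0 ≤ p)
    (h : ∀ ε : ℝ, 0 < ε → ∃ B, ‖A - B‖ ≤ ε ∧ BesselBound p B c) : BesselBound p A c := by
  choose B hAB hB using fun n : ℕ => h (1 / ((n : ℝ) + 1)) Nat.one_div_pos_of_nat
  exact BesselBound.of_tendsto hp (Eventually.of_forall hB) (tendsto_of_norm_sub_le_one_div hAB)

lemma BesselBound.norm_le (hp : 0 < p) (hc : 0 ≤ c) (hA : BesselBound p A c) : ‖A‖ ≤ c := by
  refine ContinuousLinearMap.opNorm_le_of_re_inner_le (𝕜 := ℂ) hc fun x y hx hy => ?_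
  have h := hA 1 _ _ (isBessel_singleton hx.le) (isBessel_singleton hy.le)
  simp only [Finset.univ_unique, Finset.sum_const, Finset.card_singleton, one_smul,
    Real.rpow_le_rpow_iff (norm_nonneg _) hc hp, norm_inner_symm y] at h
  exact (Complex.re_le_norm _).trans h

lemma besselBound_rankOne (hp : 1 ≤ p) (ξ η : H) :
    BesselBound p (rankOne ℂ ξ η) (‖ξ‖ * ‖η‖) := by
  intro n e f he hf
  have hp0 : p ≠ 0 := by linarith
  simp_rw [rankOne_apply, inner_smul_right, norm_mul]
  set M := ‖ξ‖ * ‖η‖ with hM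
  set t : Fin n → ℝ := fun i => ‖inner ℂ η (e i)‖ * ‖inner ℂ (f i) ξ‖
  have ht0 : ∀ i, 0 ≤ t i := fun i => by positivity
  have hsum : ∑ i, t i ≤ M := by
    refine (Real.sum_mul_le_sqrt_mul_sqrt _ _ _).trans ?_
    rw [hM, mul_comm]
    simp_rw [norm_inner_symm η]
    gcongr
    · rw [Real.sqrt_le_left (norm_nonneg _)]; exact hf ξ
    · rw [Real.sqrt_le_left (norm_nonneg _)]; exact he η
  have hle : ∀ i, t i ≤ M := fun i =>
    (Finset.single_le_sum (fun j _ => ht0 j) (Finset.mem_univ i)).trans hsum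
  calc ∑ i, t i ^ p = ∑ i, t i ^ (p - 1) * t i :=
        Finset.sum_congr rfl fun i _ => (rpow_sub_one_mul_self (ht0 i) hp0).symm
    _ ≤ ∑ i, M ^ (p - 1) * t i := by
        refine Finset.sum_le_sum fun i _ => mul_le_mul_of_nonneg_right ?_ (ht0 i)
        exact Real.rpow_le_rpow (ht0 i) (hle i) (by linarith)
    _ ≤ M ^ (p - 1) * M := by rw [← Finset.mul_sum]; gcongr
    _ = M ^ p := rpow_sub_one_mul_self (by positivity) hp0

lemma BesselBound.exists_almost_maximal (hA : BesselBound p A c) {δ : ℝ} (hδ : 0 < δ) :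
    ∃ (n : ℕ) (e f : Fin n → H), IsBessel e ∧ IsBessel f ∧
      ∀ ⦃m : ℕ⦄ ⦃e' f' : Fin m → H⦄, IsBessel e' → IsBessel f' →
        ∑ i, ‖inner ℂ (f' i) (A (e' i))‖ ^ p ≤ ∑ i, ‖inner ℂ (f i) (A (e i))‖ ^ p + δ := by
  let S : Set ℝ := {s | ∃ (n : ℕ) (e f : Fin n → H), IsBessel e ∧ IsBessel f ∧
    s = ∑ i, ‖inner ℂ (f i) (A (e i))‖ ^ p}
  have hbdd : BddAbove S := ⟨c ^ p, by
    rintro _ ⟨n, e, f, he, hf, rfl⟩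
    exact hA n e f he hf⟩
  have hne : S.Nonempty := ⟨_, 0, ![], ![], fun x => by simp, fun x => by simp, rfl⟩
  obtain ⟨_, ⟨n, e, f, he, hf, rfl⟩, hlt⟩ := exists_lt_of_lt_csSup hne (sub_lt_self (sSup S) hδ)
  refine ⟨n, e, f, he, hf, fun m e' f' he' hf' => ?_⟩
  have := le_csSup hbdd ⟨m, e', f', he', hf', rfl⟩
  linarith

/-- Compressing to the orthogonal complement of an almost maximizing pair of Bessel families leaves
almost nothing, because the two families and any pair in the complement combine to a new pair. -/
lemma BesselBound.exists_compression_le [CompleteSpace H] (hA : BesselBound p A c) {δ : ℝ}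
    (hδ : 0 < δ) : ∃ E F : Submodule ℂ H, FiniteDimensional ℂ E ∧ FiniteDimensional ℂ F ∧
      BesselBound p (Fᗮ.starProjection ∘L A ∘L Eᗮ.starProjection) δ := by
  obtain ⟨n, e, f, he, hf, hmax⟩ := hA.exists_almost_maximal (Real.rpow_pos_of_pos hδ p)
  set E := Submodule.span ℂ (Set.range e)
  set F := Submodule.span ℂ (Set.range f)
  have : FiniteDimensional ℂ E := FiniteDimensional.span_of_finite ℂ (Set.finite_range e)
  have : FiniteDimensional ℂ F := FiniteDimensional.span_of_finite ℂ (Set.finite_range f)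
  refine ⟨E, F, inferInstance, inferInstance, fun m e' f' he' hf' => ?_⟩
  have heE := he.sumElim_orthogonal he' E fun i => Submodule.subset_span ⟨i, rfl⟩
  have hfF := hf.sumElim_orthogonal hf' F fun i => Submodule.subset_span ⟨i, rfl⟩
  have h := hmax (heE.reindex finSumFinEquiv.symm) (hfF.reindex finSumFinEquiv.symm)
  rw [Equiv.sum_comp finSumFinEquiv.symm fun i =>
    ‖inner ℂ (Sum.elim f _ i) (A (Sum.elim e _ i))‖ ^ p, Fintype.sum_sum_type] at h
  simpa only [ContinuousLinearMap.comp_apply, Sum.elim_inl, Sum.elim_inr, add_le_add_iff_left,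
    Submodule.inner_starProjection_left_eq_right] using h

lemma BesselBound.exists_finiteRank [CompleteSpace H] (hA : BesselBound p A c) {δ : ℝ}
    (hδ : 0 < δ) : ∃ B ∈ finiteRank H, BesselBound p (A - B) δ := by
  obtain ⟨E, F, _, _, h⟩ := hA.exists_compression_le hδ
  exact ⟨_, sub_compression_mem_finiteRank A E F, by rwa [sub_sub_cancel]⟩

lemma BesselBound.isCompactOperator [CompleteSpace H] (hp : 0 < p) (hA : BesselBound p A c) :
    IsCompactOperator A := by
  choose B hB hAB using fun n : ℕ =>
    hA.exists_finiteRank (δ := 1 / ((n : ℝ) + 1)) Nat.one_div_pos_of_nat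
  exact isCompactOperator_of_tendsto
    (tendsto_of_norm_sub_le_one_div fun n => (hAB n).norm_le hp (by positivity))
    (Eventually.of_forall fun n => isCompactOperator_of_mem_finiteRank (hB n))

end BesselBound

section Variational

variable {H : Type u} [NormedAddCommGroup H] [InnerProductSpace ℂ H] [CompleteSpace H]
variable {p c : ℝ} {a A : H →L[ℂ] H}

lemma inner_sqrt_apply_sqrt_apply (ha : 0 ≤ a) (x y : H) :
    inner ℂ (CFC.sqrt a x) (CFC.sqrt a y) = inner ℂ x (a y) := by
  have hs : IsSelfAdjoint (CFC.sqrt a) := IsSelfAdjoint.of_nonneg (CFC.sqrt_nonneg a)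
  rw [← ContinuousLinearMap.adjoint_inner_right, ← ContinuousLinearMap.star_eq_adjoint,
    hs.star_eq, ← mul_apply_eq_comp, CFC.sqrt_mul_sqrt_self a ha]

lemma norm_inner_mul_rpow_le (ha : 0 ≤ a) (U : H →L[ℂ] H) (hp : 0 < p) (x y : H) :
    ‖inner ℂ x ((U * a) y)‖ ^ p ≤
      ((inner ℂ (star U x) (a (star U x))).re ^ p + (inner ℂ y (a y)).re ^ p) / 2 := by
  set s := CFC.sqrt a
  have hnorm : ∀ z, (inner ℂ z (a z)).re = ‖s z‖ ^ 2 := fun z => by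
    rw [← inner_sqrt_apply_sqrt_apply ha, norm_sq_eq_re_inner (𝕜 := ℂ)]
    rfl
  have hpow : ∀ r : ℝ, 0 ≤ r → (r ^ 2) ^ p = (r ^ p) ^ 2 := fun r hr => by
    rw [← Real.rpow_natCast, ← Real.rpow_natCast, ← Real.rpow_mul hr, ← Real.rpow_mul hr, mul_comm]
  have hcs : ‖inner ℂ x ((U * a) y)‖ ^ p ≤ ‖s (star U x)‖ ^ p * ‖s y‖ ^ p := by
    rw [← Real.mul_rpow (norm_nonneg _) (norm_nonneg _), mul_apply_eq_comp,
      ← ContinuousLinearMap.adjoint_inner_left, ← ContinuousLinearMap.star_eq_adjoint,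
      ← inner_sqrt_apply_sqrt_apply ha]
    exact Real.rpow_le_rpow (norm_nonneg _) (norm_inner_le_norm _ _) hp.le
  rw [hnorm, hnorm, hpow _ (norm_nonneg _), hpow _ (norm_nonneg _)]
  nlinarith [sq_nonneg (‖s (star U x)‖ ^ p - ‖s y‖ ^ p)]

lemma besselBound_of_posTrace_le (hp : 1 ≤ p) (hc : 0 ≤ c)
    (h : posTrace (CFC.abs A ^ p) ≤ ENNReal.ofReal (c ^ p)) : BesselBound p A c := by
  refine BesselBound.of_norm_sub_le (by linarith) fun ε hε => ?_
  obtain ⟨U, hU, hAU, -⟩ := exists_approx_polar A hε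
  refine ⟨U * CFC.abs A, hAU, fun n e f he hf => ?_⟩
  have ha := CFC.abs_nonneg A
  have hdiag : ∀ g : Fin n → H, IsBessel g →
      ∑ i, (inner ℂ (g i) (CFC.abs A (g i))).re ^ p ≤ c ^ p := fun g hg => by
    have := (hg.sum_re_inner_rpow_le ha hp).trans h
    rwa [← ENNReal.ofReal_sum_of_nonneg fun i _ =>
      Real.rpow_nonneg (re_inner_nonneg_of_nonneg ha (g i)) p,
      ENNReal.ofReal_le_ofReal_iff (Real.rpow_nonneg hc p)] at this
  have he' := hdiag _ he
  have hf' := hdiag _ (hf.map (V := star U) (by rwa [norm_star]))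
  refine (Finset.sum_le_sum fun i _ =>
    norm_inner_mul_rpow_le ha U (by linarith) (f i) (e i)).trans ?_
  rw [← Finset.sum_div, Finset.sum_add_distrib]
  linarith

lemma BesselBound.abs (hp : 0 ≤ p) (h : BesselBound p A c) : BesselBound p (CFC.abs A) c := by
  refine BesselBound.of_norm_sub_le hp fun ε hε => ?_
  obtain ⟨U, hU, -, hAU⟩ := exists_approx_polar A hε
  refine ⟨star U * A, hAU, fun n e f he hf => ?_⟩
  simp_rw [mul_apply_eq_comp, ContinuousLinearMap.star_eq_adjoint,
    ContinuousLinearMap.adjoint_inner_right]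
  exact h n e _ he (hf.map (V := U) hU)

lemma completeSpace_eigenspace (a : H →L[ℂ] H) (μ : ℂ) :
    CompleteSpace (Module.End.eigenspace (a : Module.End ℂ H) μ) := by
  have h : IsClosed (Module.End.eigenspace (a : Module.End ℂ H) μ : Set H) := by
    have hset : (Module.End.eigenspace (a : Module.End ℂ H) μ : Set H) = {x | a x = μ • x} :=
      Set.ext fun _ => Module.End.mem_eigenspace_iff
    rw [hset]
    exact isClosed_eq a.continuous (continuous_const_smul μ)
  exact h.completeSpace_coe

omit [CompleteSpace H] in
lemma span_range_hilbertBasis_orthogonal {ι : Type*} {V : ι → Submodule ℂ H} {κ : ι → Type*}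
    [∀ i, CompleteSpace (V i)] (b : ∀ i, HilbertBasis (κ i) ℂ (V i)) :
    (Submodule.span ℂ (Set.range fun j : Σ i, κ i => (b j.1 j.2 : H)))ᗮ = (⨆ i, V i)ᗮ := by
  refine le_antisymm (fun x hx => ?_) (Submodule.orthogonal_le (Submodule.span_le.mpr ?_))
  · rw [← Submodule.iInf_orthogonal, Submodule.mem_iInf]
    refine fun i => Submodule.orthogonalProjectionOnto_eq_zero_iff.mp ((b i).repr.injective ?_)
    ext j
    rw [(b i).repr_apply_apply, map_zero,
      Submodule.inner_orthogonalProjectionOnto_eq_of_mem_left]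
    exact hx _ (Submodule.subset_span ⟨⟨i, j⟩, rfl⟩)
  · rintro _ ⟨j, rfl⟩
    exact Submodule.mem_iSup_of_mem j.1 (b j.1 j.2).2

lemma exists_hilbertBasis_of_orthogonalFamily {ι : Type v} {V : ι → Submodule ℂ H}
    [∀ i, CompleteSpace (V i)] (hV : OrthogonalFamily ℂ (fun i => V i) fun i => (V i).subtypeₗᵢ)
    (hbot : (⨆ i, V i)ᗮ = ⊥) :
    ∃ (κ : Type (max u v)) (f : HilbertBasis κ ℂ H), ∀ j, ∃ i, f j ∈ V i := by
  have hon : Orthonormal ℂ fun j : Σ i, stdBasisIndex (V i) => (stdBasis (V j.1) j.2 : H) :=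
    hV.orthonormal_sigma_orthonormal fun i => (stdBasis (V i)).orthonormal
  refine ⟨_, HilbertBasis.mkOfOrthogonalEqBot hon
    ((span_range_hilbertBasis_orthogonal fun i => stdBasis (V i)).trans hbot), fun j => ⟨j.1, ?_⟩⟩
  rw [HilbertBasis.coe_mkOfOrthogonalEqBot]
  exact (stdBasis (V j.1) j.2).2

lemma exists_hilbertBasis_eigenvectors (ha : IsSelfAdjoint a) (hcomp : IsCompactOperator a) :
    ∃ (κ : Type u) (f : HilbertBasis κ ℂ H) (l : κ → ℝ), ∀ j, a (f j) = (l j : ℂ) • f j := by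
  have hsymm : (a : H →ₗ[ℂ] H).IsSymmetric :=
    ContinuousLinearMap.isSelfAdjoint_iff_isSymmetric.mp ha
  have := completeSpace_eigenspace a
  obtain ⟨κ, f, hf⟩ := exists_hilbertBasis_of_orthogonalFamily hsymm.orthogonalFamily_eigenspaces
    (ContinuousLinearMap.orthogonalComplement_iSup_eigenspaces_eq_bot hcomp hsymm)
  choose l hl using hf
  refine ⟨κ, f, fun j => (l j).re, fun j => ?_⟩
  have hlj : a (f j) = l j • f j := Module.End.mem_eigenspace_iff.mp (hl j)
  have hne : f j ≠ 0 := f.orthonormal.ne_zero j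
  rw [Complex.conj_eq_iff_re.mp (hsymm.conj_eigenvalue_eq_self
    (Module.End.hasEigenvalue_of_hasEigenvector ⟨hl j, hne⟩)), hlj]

lemma BesselBound.posTrace_rpow_le (hp : 1 ≤ p) (ha : 0 ≤ a) (h : BesselBound p a c) :
    posTrace (a ^ p) ≤ ENNReal.ofReal (c ^ p) := by
  have hp0 : 0 < p := by linarith
  obtain ⟨κ, f, l, hf⟩ :=
    exists_hilbertBasis_eigenvectors (IsSelfAdjoint.of_nonneg ha) (h.isCompactOperator hp0)
  have hinner : ∀ j, inner ℂ (f j) (a (f j)) = (l j : ℂ) := fun j => by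
    rw [hf, inner_smul_right, inner_self_eq_norm_sq_to_K, f.orthonormal.1 j]
    simp
  have hl : ∀ j, 0 ≤ l j := fun j => by
    simpa only [hinner, Complex.ofReal_re] using re_inner_nonneg_of_nonneg ha (f j)
  set b := cfc (fun t : ℝ => t ^ (p / 2)) a with hb
  have hbf : ∀ j, ‖b (f j)‖ ^ 2 = l j ^ p := fun j => by
    rw [hb, cfc_apply_of_eigenvector (IsSelfAdjoint.of_nonneg ha) (hf j)
      (Real.continuous_rpow_const (by linarith)), norm_smul, f.orthonormal.1 j, mul_one,
      Complex.norm_of_nonneg (Real.rpow_nonneg (hl j) _), rpow_half_sq (hl j)]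
  have hfin : ∀ t : Finset κ, ∑ j ∈ t, l j ^ p ≤ c ^ p := fun t => by
    have ht : IsBessel fun j : t => f j :=
      isBessel_of_orthonormal (f.orthonormal.comp _ Subtype.val_injective)
    refine le_trans (le_of_eq ?_) (h.sum_le ht ht)
    rw [← Finset.sum_coe_sort]
    exact Finset.sum_congr rfl fun j _ => by rw [hinner, Complex.norm_of_nonneg (hl j)]
  have htrace : ∑' j, ENNReal.ofReal (‖b (f j)‖ ^ 2) ≤ ENNReal.ofReal (c ^ p) := by
    simp_rw [hbf]
    refine ENNReal.summable.tsum_le_of_sum_le fun t => ?_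
    rw [← ENNReal.ofReal_sum_of_nonneg fun j _ => Real.rpow_nonneg (hl j) p]
    exact ENNReal.ofReal_le_ofReal (hfin t)
  rw [posTrace_rpow ha hp0.le]
  refine ENNReal.summable.tsum_le_of_sum_le fun s => ?_
  rw [← Finset.sum_coe_sort]
  have hs : IsBessel fun i : s => stdBasis H i :=
    isBessel_of_orthonormal ((stdBasis H).orthonormal.comp _ Subtype.val_injective)
  exact (hs.sum_norm_sq_le_tsum f IsSelfAdjoint.cfc).trans htrace

lemma one_le_toReal {p : ℝ≥0∞} (hp : 1 ≤ p) (hp' : p ≠ ∞) : 1 ≤ p.toReal := by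
  rw [← ENNReal.toReal_one]
  exact ENNReal.toReal_mono hp' hp

lemma schattenNorm_le_ofReal_iff {p : ℝ≥0∞} (hp : 1 ≤ p) (hp' : p ≠ ∞) (hc : 0 ≤ c) :
    schattenNorm p A ≤ ENNReal.ofReal c ↔ BesselBound p.toReal A c := by
  have h1 := one_le_toReal hp hp'
  have h0 : 0 < p.toReal := by linarith
  rw [schattenNorm, if_neg hp', one_div, ENNReal.rpow_inv_le_iff h0,
    ENNReal.ofReal_rpow_of_nonneg hc h0.le]
  exact ⟨besselBound_of_posTrace_le h1 hc,
    fun h => (h.abs h0.le).posTrace_rpow_le h1 (CFC.abs_nonneg A)⟩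

end Variational

section SchattenClass

variable {H : Type*} [NormedAddCommGroup H] [InnerProductSpace ℂ H]
variable {H' : Type*} [NormedAddCommGroup H'] [InnerProductSpace ℂ H']
variable {p : ℝ≥0∞}

/-- The inequality `‖A‖_p ≤ c` for all `p`, with the variational form for `p < ∞`; unlike
`schattenNorm` it needs no square root of `A⋆ A`, which makes it stable under sums and limits. -/
def SchattenBound (p : ℝ≥0∞) (A : H →L[ℂ] H) (c : ℝ) : Prop :=
  if p = ∞ then ‖A‖ ≤ c else BesselBound p.toReal A c

lemma SchattenBound.add (hp : 1 ≤ p) {A B : H →L[ℂ] H} {c d : ℝ} (hc : 0 ≤ c) (hd : 0 ≤ d)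
    (hA : SchattenBound p A c) (hB : SchattenBound p B d) : SchattenBound p (A + B) (c + d) := by
  unfold SchattenBound at *
  split_ifs with h
  · rw [if_pos h] at hA hB
    exact (norm_add_le _ _).trans (add_le_add hA hB)
  · rw [if_neg h] at hA hB
    exact hA.add (one_le_toReal hp h) hc hd hB

lemma SchattenBound.conj [CompleteSpace H] [CompleteSpace H'] {A : H →L[ℂ] H} {c : ℝ}
    (hc : 0 ≤ c) (hA : SchattenBound p A c) (V : H →L[ℂ] H') (W : H' →L[ℂ] H) :
    SchattenBound p (V ∘L A ∘L W) (‖V‖ * c * ‖W‖) := by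
  unfold SchattenBound at *
  split_ifs with h
  · rw [if_pos h] at hA
    refine (ContinuousLinearMap.opNorm_comp_le _ _).trans ?_
    rw [mul_assoc]
    gcongr
    refine (ContinuousLinearMap.opNorm_comp_le _ _).trans ?_
    gcongr
  · rw [if_neg h] at hA
    exact hA.conj hc V W

lemma SchattenBound.norm_le (hp : 1 ≤ p) {A : H →L[ℂ] H} {c : ℝ} (hc : 0 ≤ c)
    (hA : SchattenBound p A c) : ‖A‖ ≤ c := by
  unfold SchattenBound at hA
  split_ifs at hA with h
  · exact hA
  · exact hA.norm_le (by linarith [one_le_toReal hp h]) hc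

lemma SchattenBound.of_tendsto {α : Type*} {l : Filter α} [l.NeBot]
    {B : α → H →L[ℂ] H} {A : H →L[ℂ] H} {c : ℝ} (hB : ∀ᶠ k in l, SchattenBound p (B k) c)
    (h : Tendsto B l (𝓝 A)) : SchattenBound p A c := by
  unfold SchattenBound at *
  split_ifs with hp
  · simp only [if_pos hp] at hB
    exact le_of_tendsto h.norm hB
  · simp only [if_neg hp] at hB
    exact BesselBound.of_tendsto ENNReal.toReal_nonneg hB h

lemma schattenBound_rankOne (hp : 1 ≤ p) (ξ η : H) :
    SchattenBound p (rankOne ℂ ξ η) (‖ξ‖ * ‖η‖) := by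
  unfold SchattenBound
  split_ifs with h
  · exact (norm_rankOne ξ η).le
  · exact besselBound_rankOne (one_le_toReal hp h) ξ η

variable [CompleteSpace H] [CompleteSpace H']

lemma schattenNorm_le_iff (hp : 1 ≤ p) {A : H →L[ℂ] H} {c : ℝ} (hc : 0 ≤ c) :
    schattenNorm p A ≤ ENNReal.ofReal c ↔ SchattenBound p A c := by
  unfold SchattenBound
  split_ifs with h
  · rw [schattenNorm, if_pos h, ← ofReal_norm, ENNReal.ofReal_le_ofReal_iff hc]
  · exact schattenNorm_le_ofReal_iff hp h hc

lemma memSchatten_iff (hp : 1 ≤ p) (hp' : p ≠ ∞) {A : H →L[ℂ] H} :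
    MemSchatten p A ↔ schattenNorm p A < ∞ := by
  have h0 : 0 < p.toReal := by linarith [one_le_toReal hp hp']
  rw [MemSchatten, schattenNorm, if_neg hp', if_neg hp', one_div,
    ENNReal.rpow_lt_top_iff_of_pos (by positivity)]

lemma SchattenBound.memSchatten (hp : 1 ≤ p) (hp' : p ≠ ∞) {A : H →L[ℂ] H} {c : ℝ} (hc : 0 ≤ c)
    (h : SchattenBound p A c) : MemSchatten p A :=
  (memSchatten_iff hp hp').mpr (((schattenNorm_le_iff hp hc).mpr h).trans_lt ENNReal.ofReal_lt_top)

/-- The Schatten norm as a real number, for use on operators satisfying `MemSchatten p`; it is `0`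
when the norm is infinite. -/
def schattenReal (p : ℝ≥0∞) (A : H →L[ℂ] H) : ℝ := (schattenNorm p A).toReal

lemma schattenReal_nonneg (A : H →L[ℂ] H) : 0 ≤ schattenReal p A := ENNReal.toReal_nonneg

lemma MemSchatten.schattenNorm_ne_top (hp : 1 ≤ p) {A : H →L[ℂ] H} (hA : MemSchatten p A) :
    schattenNorm p A ≠ ∞ := by
  by_cases h : p = ∞
  · rw [schattenNorm, if_pos h]
    exact enorm_ne_top
  · exact ((memSchatten_iff hp h).mp hA).ne

lemma MemSchatten.ofReal_schattenReal (hp : 1 ≤ p) {A : H →L[ℂ] H} (hA : MemSchatten p A) :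
    ENNReal.ofReal (schattenReal p A) = schattenNorm p A :=
  ENNReal.ofReal_toReal (hA.schattenNorm_ne_top hp)

lemma SchattenBound.schattenReal_le (hp : 1 ≤ p) {A : H →L[ℂ] H} {c : ℝ} (hc : 0 ≤ c)
    (h : SchattenBound p A c) : schattenReal p A ≤ c :=
  ENNReal.toReal_le_of_le_ofReal hc ((schattenNorm_le_iff hp hc).mpr h)

lemma MemSchatten.schattenBound (hp : 1 ≤ p) {A : H →L[ℂ] H} (hA : MemSchatten p A) :
    SchattenBound p A (schattenReal p A) :=
  (schattenNorm_le_iff hp (schattenReal_nonneg A)).mp (hA.ofReal_schattenReal hp).ge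

lemma MemSchatten.norm_le (hp : 1 ≤ p) {A : H →L[ℂ] H} (hA : MemSchatten p A) :
    ‖A‖ ≤ schattenReal p A :=
  (hA.schattenBound hp).norm_le hp (schattenReal_nonneg A)

lemma MemSchatten.add (hp : 1 ≤ p) {A B : H →L[ℂ] H} (hA : MemSchatten p A)
    (hB : MemSchatten p B) : MemSchatten p (A + B) := by
  by_cases h : p = ∞
  · rw [MemSchatten, if_pos h] at *
    exact IsCompactOperator.add hA hB
  · exact ((hA.schattenBound hp).add hp (schattenReal_nonneg A) (schattenReal_nonneg B)
      (hB.schattenBound hp)).memSchatten hp h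
      (add_nonneg (schattenReal_nonneg A) (schattenReal_nonneg B))

lemma schattenReal_add_le (hp : 1 ≤ p) {A B : H →L[ℂ] H} (hA : MemSchatten p A)
    (hB : MemSchatten p B) : schattenReal p (A + B) ≤ schattenReal p A + schattenReal p B :=
  ((hA.schattenBound hp).add hp (schattenReal_nonneg A) (schattenReal_nonneg B)
    (hB.schattenBound hp)).schattenReal_le hp
    (add_nonneg (schattenReal_nonneg A) (schattenReal_nonneg B))

lemma MemSchatten.conj (hp : 1 ≤ p) {A : H →L[ℂ] H} (hA : MemSchatten p A) (V : H →L[ℂ] H')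
    (W : H' →L[ℂ] H) : MemSchatten p (V ∘L A ∘L W) := by
  by_cases h : p = ∞
  · rw [MemSchatten, if_pos h] at *
    exact (hA.comp_clm W).clm_comp V
  · have := schattenReal_nonneg (p := p) A
    exact ((hA.schattenBound hp).conj (schattenReal_nonneg A) V W).memSchatten hp h (by positivity)

lemma schattenReal_conj_le (hp : 1 ≤ p) {A : H →L[ℂ] H} (hA : MemSchatten p A) (V : H →L[ℂ] H')
    (W : H' →L[ℂ] H) :
    schattenReal p (V ∘L A ∘L W) ≤ ‖V‖ * schattenReal p A * ‖W‖ := by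
  have := schattenReal_nonneg (p := p) A
  exact ((hA.schattenBound hp).conj this V W).schattenReal_le hp (by positivity)

lemma schattenReal_conj_le_of_le (hp : 1 ≤ p) {A : H →L[ℂ] H} (hA : MemSchatten p A)
    {V : H →L[ℂ] H'} {W : H' →L[ℂ] H} {v w : ℝ} (hV : ‖V‖ ≤ v) (hW : ‖W‖ ≤ w) :
    schattenReal p (V ∘L A ∘L W) ≤ v * schattenReal p A * w := by
  have := schattenReal_nonneg (p := p) A
  have := (norm_nonneg V).trans hV
  refine (schattenReal_conj_le hp hA V W).trans ?_
  gcongr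

omit [CompleteSpace H] in
lemma smul_eq_conj (c : ℂ) (A : H →L[ℂ] H) :
    c • A = (c • ContinuousLinearMap.id ℂ H) ∘L A ∘L ContinuousLinearMap.id ℂ H := by
  ext x
  simp

lemma MemSchatten.smul (hp : 1 ≤ p) (c : ℂ) {A : H →L[ℂ] H} (hA : MemSchatten p A) :
    MemSchatten p (c • A) := by
  rw [smul_eq_conj]
  exact hA.conj hp _ _

lemma schattenReal_smul_le (hp : 1 ≤ p) (c : ℂ) {A : H →L[ℂ] H} (hA : MemSchatten p A) :
    schattenReal p (c • A) ≤ ‖c‖ * schattenReal p A := by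
  have hc : ‖c • ContinuousLinearMap.id ℂ H‖ ≤ ‖c‖ := by
    rw [norm_smul]
    exact mul_le_of_le_one_right (norm_nonneg c) ContinuousLinearMap.norm_id_le
  rw [smul_eq_conj]
  simpa only [mul_one] using
    schattenReal_conj_le_of_le hp hA hc ContinuousLinearMap.norm_id_le

lemma memSchatten_rankOne (hp : 1 ≤ p) (ξ η : H) : MemSchatten p (rankOne ℂ ξ η) := by
  by_cases h : p = ∞
  · rw [MemSchatten, if_pos h]
    exact isCompactOperator_rankOne ξ η
  · exact (schattenBound_rankOne hp ξ η).memSchatten hp h (by positivity)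

lemma schattenReal_rankOne_le (hp : 1 ≤ p) (ξ η : H) :
    schattenReal p (rankOne ℂ ξ η) ≤ ‖ξ‖ * ‖η‖ :=
  (schattenBound_rankOne hp ξ η).schattenReal_le hp (by positivity)

lemma memSchatten_zero (hp : 1 ≤ p) : MemSchatten p (0 : H →L[ℂ] H) := by
  simpa using memSchatten_rankOne hp (0 : H) 0

lemma MemSchatten.sub (hp : 1 ≤ p) {A B : H →L[ℂ] H} (hA : MemSchatten p A)
    (hB : MemSchatten p B) : MemSchatten p (A - B) := by
  have := hA.add hp (hB.smul hp (-1))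
  rwa [neg_one_smul, ← sub_eq_add_neg] at this

lemma schattenReal_sub_le (hp : 1 ≤ p) {A B : H →L[ℂ] H} (hA : MemSchatten p A)
    (hB : MemSchatten p B) : schattenReal p (A - B) ≤ schattenReal p A + schattenReal p B := by
  have h1 := schattenReal_add_le hp hA (hB.smul hp (-1))
  have h2 := schattenReal_smul_le hp (-1) hB
  rw [neg_one_smul, ← sub_eq_add_neg] at h1
  rw [norm_neg, norm_one, one_mul, neg_one_smul] at h2
  linarith

lemma MemSchatten.sum (hp : 1 ≤ p) {ι : Type*} (s : Finset ι) {A : ι → H →L[ℂ] H}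
    (hA : ∀ i ∈ s, MemSchatten p (A i)) : MemSchatten p (∑ i ∈ s, A i) := by
  classical
  induction s using Finset.induction_on with
  | empty => simpa only [Finset.sum_empty] using memSchatten_zero hp
  | insert i s hi ih =>
    rw [Finset.sum_insert hi]
    exact (hA i (by simp)).add hp (ih fun j hj => hA j (by simp [hj]))

lemma MemSchatten.of_tendsto (hp : 1 ≤ p) {α : Type*} {l : Filter α} [l.NeBot]
    {B : α → H →L[ℂ] H} {A : H →L[ℂ] H} {c : ℝ} (hc : 0 ≤ c)
    (hB : ∀ᶠ k in l, MemSchatten p (B k) ∧ schattenReal p (B k) ≤ c)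
    (h : Tendsto B l (𝓝 A)) : MemSchatten p A ∧ schattenReal p A ≤ c := by
  have hA : SchattenBound p A c := by
    refine SchattenBound.of_tendsto (hB.mono fun k hk => ?_) h
    rw [← schattenNorm_le_iff hp hc, ← hk.1.ofReal_schattenReal hp]
    exact ENNReal.ofReal_le_ofReal hk.2
  refine ⟨?_, hA.schattenReal_le hp hc⟩
  by_cases hp' : p = ∞
  · rw [MemSchatten, if_pos hp']
    simp only [MemSchatten, if_pos hp'] at hB
    exact isCompactOperator_of_tendsto h (hB.mono fun k hk => hk.1)
  · exact hA.memSchatten hp hp' hc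

lemma memSchatten_of_mem_finiteRank (hp : 1 ≤ p) {A : H →L[ℂ] H} (hA : A ∈ finiteRank H) :
    MemSchatten p A := by
  induction hA using Submodule.span_induction with
  | mem A h => obtain ⟨ξη, rfl⟩ := h; exact memSchatten_rankOne hp _ _
  | zero => exact memSchatten_zero hp
  | add A B _ _ hA hB => exact hA.add hp hB
  | smul c A _ hA => exact hA.smul hp c

end SchattenClass

section Approximation

variable {H : Type*} [NormedAddCommGroup H] [InnerProductSpace ℂ H] [CompleteSpace H]
variable {H' : Type*} [NormedAddCommGroup H'] [InnerProductSpace ℂ H'] [CompleteSpace H']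
variable {p : ℝ≥0∞}

lemma exists_finiteRank_norm_sub_le {A : H →L[ℂ] H} (hA : IsCompactOperator A) {δ : ℝ}
    (hδ : 0 < δ) : ∃ B ∈ finiteRank H, ‖A - B‖ ≤ δ := by
  have hbounded := (IsCompactOperator.isCompact_closure_image_closedBall (𝕜₁ := ℂ) (𝕜₂ := ℂ)
    (f := (A : H →ₗ[ℂ] H)) hA 1).totallyBounded
  obtain ⟨net, hfin, hnet⟩ := Metric.totallyBounded_iff.mp hbounded δ hδ
  set P := Submodule.span ℂ net
  have : FiniteDimensional ℂ P := FiniteDimensional.span_of_finite ℂ hfin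
  refine ⟨P.starProjection ∘L A, mem_finiteRank_of_finiteDimensional_range ?_, ?_⟩
  · refine Submodule.finiteDimensional_of_le (S₂ := P) ?_
    rintro _ ⟨x, rfl⟩
    exact Submodule.starProjection_apply_mem P _
  · refine ContinuousLinearMap.opNorm_le_of_unit_norm hδ.le fun x hx => ?_
    have hmem : A x ∈ closure ((A : H →ₗ[ℂ] H) '' Metric.closedBall 0 1) :=
      subset_closure ⟨x, by simp [hx], rfl⟩
    obtain ⟨y, hy, hxy⟩ := Set.mem_iUnion₂.mp (hnet hmem)
    have hPy : P.starProjection y = y :=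
      Submodule.starProjection_eq_self_iff.mpr (Submodule.subset_span hy)
    have hdiff : (A - P.starProjection ∘L A) x = Pᗮ.starProjection (A x - y) := by
      rw [Submodule.starProjection_orthogonal']
      simp [hPy]
    rw [hdiff]
    refine (Submodule.norm_starProjection_apply_le _ _).trans ?_
    rw [← dist_eq_norm]
    exact (Metric.mem_ball.mp hxy).le

lemma MemSchatten.exists_finiteRank (hp : 1 ≤ p) {A : H →L[ℂ] H} (hA : MemSchatten p A) {δ : ℝ}
    (hδ : 0 < δ) : ∃ B ∈ finiteRank H, schattenReal p (A - B) ≤ δ := by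
  have hbound := hA.schattenBound hp
  suffices h : ∃ B ∈ finiteRank H, SchattenBound p (A - B) δ by
    obtain ⟨B, hB, hAB⟩ := h
    exact ⟨B, hB, hAB.schattenReal_le hp hδ.le⟩
  unfold SchattenBound at *
  by_cases hp' : p = ∞
  · simp only [if_pos hp']
    rw [MemSchatten, if_pos hp'] at hA
    exact exists_finiteRank_norm_sub_le hA hδ
  · simp only [if_neg hp'] at hbound ⊢
    exact hbound.exists_finiteRank hδ

lemma conj_adjoint_rankOne (V W : H →L[ℂ] H') (ξ η : H) :
    V ∘L rankOne ℂ ξ η ∘L adjoint W = rankOne ℂ (V ξ) (W η) := by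
  rw [rankOne_comp, comp_rankOne, ContinuousLinearMap.adjoint_adjoint]

lemma schattenReal_rankOne_sub_rankOne_le (hp : 1 ≤ p) (ξ η ξ' η' : H) :
    schattenReal p (rankOne ℂ ξ η - rankOne ℂ ξ' η') ≤ ‖ξ - ξ'‖ * ‖η‖ + ‖ξ'‖ * ‖η - η'‖ := by
  have hsplit : rankOne ℂ ξ η - rankOne ℂ ξ' η' =
      rankOne ℂ (ξ - ξ') η + rankOne ℂ ξ' (η - η') := by
    simp only [map_sub, sub_apply]
    abel
  rw [hsplit]
  exact (schattenReal_add_le hp (memSchatten_rankOne hp _ _) (memSchatten_rankOne hp _ _)).trans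
    (add_le_add (schattenReal_rankOne_le hp _ _) (schattenReal_rankOne_le hp _ _))

variable {α : Type*} {l : Filter α} {V W : α → H →L[ℂ] H'} {V₀ W₀ : H →L[ℂ] H'}

lemma tendsto_schattenReal_conj_sub_of_mem_finiteRank (hp : 1 ≤ p)
    (hV : ∀ x, Tendsto (fun k => V k x) l (𝓝 (V₀ x)))
    (hW : ∀ x, Tendsto (fun k => W k x) l (𝓝 (W₀ x))) {Z : H →L[ℂ] H} (hZ : Z ∈ finiteRank H) :
    Tendsto (fun k => schattenReal p (V k ∘L Z ∘L adjoint (W k) - V₀ ∘L Z ∘L adjoint W₀))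
      l (𝓝 0) := by
  have hmem : ∀ {Z : H →L[ℂ] H}, Z ∈ finiteRank H → ∀ k,
      MemSchatten p (V k ∘L Z ∘L adjoint (W k) - V₀ ∘L Z ∘L adjoint W₀) := fun hZ k =>
    ((memSchatten_of_mem_finiteRank hp hZ).conj hp _ _).sub hp
      ((memSchatten_of_mem_finiteRank hp hZ).conj hp _ _)
  induction hZ using Submodule.span_induction with
  | mem Z h =>
    obtain ⟨⟨ξ, η⟩, rfl⟩ := h
    simp only [conj_adjoint_rankOne]
    refine squeeze_zero (fun k => schattenReal_nonneg _)
      (fun k => schattenReal_rankOne_sub_rankOne_le hp _ _ _ _) ?_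
    have hVξ := tendsto_iff_norm_sub_tendsto_zero.mp (hV ξ)
    have hWη := tendsto_iff_norm_sub_tendsto_zero.mp (hW η)
    simpa using (hVξ.mul (hW η).norm).add (hWη.const_mul ‖V₀ ξ‖)
  | zero =>
    have hzero : schattenReal p (0 : H' →L[ℂ] H') = 0 :=
      le_antisymm (by simpa using schattenReal_rankOne_le hp (0 : H') (0 : H'))
        (schattenReal_nonneg _)
    simpa [hzero] using tendsto_const_nhds
  | add Z Z' hZ hZ' ih ih' =>
    refine squeeze_zero (fun k => schattenReal_nonneg _) (fun k => ?_) (by simpa using ih.add ih')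
    simp only [ContinuousLinearMap.add_comp, ContinuousLinearMap.comp_add, add_sub_add_comm]
    exact schattenReal_add_le hp (hmem hZ k) (hmem hZ' k)
  | smul c Z hZ ih =>
    refine squeeze_zero (fun k => schattenReal_nonneg _) (fun k => ?_)
      (by simpa using ih.const_mul ‖c‖)
    simp only [ContinuousLinearMap.smul_comp, ContinuousLinearMap.comp_smul, ← smul_sub]
    exact schattenReal_smul_le hp c (hmem hZ k)

lemma MemSchatten.tendsto_schattenReal_conj_sub (hp : 1 ≤ p)
    (hV : ∀ x, Tendsto (fun k => V k x) l (𝓝 (V₀ x)))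
    (hW : ∀ x, Tendsto (fun k => W k x) l (𝓝 (W₀ x))) (hV1 : ∀ k, ‖V k‖ ≤ 1)
    (hW1 : ∀ k, ‖W k‖ ≤ 1) (hV₀ : ‖V₀‖ ≤ 1) (hW₀ : ‖W₀‖ ≤ 1)
    {Z : H →L[ℂ] H} (hZ : MemSchatten p Z) :
    Tendsto (fun k => schattenReal p (V k ∘L Z ∘L adjoint (W k) - V₀ ∘L Z ∘L adjoint W₀))
      l (𝓝 0) := by
  rw [Metric.tendsto_nhds]
  intro ε hε
  obtain ⟨B, hB, hZB⟩ := hZ.exists_finiteRank hp (show 0 < ε / 4 by positivity)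
  have hBm := memSchatten_of_mem_finiteRank hp hB
  have hD := hZ.sub hp hBm
  have hlim := tendsto_schattenReal_conj_sub_of_mem_finiteRank hp hV hW hB
  have hconj : ∀ {V W : H →L[ℂ] H'}, ‖V‖ ≤ 1 → ‖W‖ ≤ 1 →
      schattenReal p (V ∘L (Z - B) ∘L adjoint W) ≤ ε / 4 := fun {V W} hV hW => by
    have := schattenReal_conj_le_of_le hp hD hV
      (show ‖adjoint W‖ ≤ 1 by rwa [LinearIsometryEquiv.norm_map])
    linarith
  filter_upwards [hlim.eventually_lt_const (show 0 < ε / 4 by positivity)] with k hk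
  rw [Real.dist_0_eq_abs, abs_of_nonneg (schattenReal_nonneg _)]
  have hsplit : V k ∘L Z ∘L adjoint (W k) - V₀ ∘L Z ∘L adjoint W₀ =
      (V k ∘L (Z - B) ∘L adjoint (W k) - V₀ ∘L (Z - B) ∘L adjoint W₀) +
        (V k ∘L B ∘L adjoint (W k) - V₀ ∘L B ∘L adjoint W₀) := by
    simp only [ContinuousLinearMap.sub_comp, ContinuousLinearMap.comp_sub]
    abel
  rw [hsplit]
  have hsub := schattenReal_sub_le hp (hD.conj hp (V k) (adjoint (W k)))
    (hD.conj hp V₀ (adjoint W₀))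
  have hadd := schattenReal_add_le hp
    ((hD.conj hp (V k) (adjoint (W k))).sub hp (hD.conj hp V₀ (adjoint W₀)))
    ((hBm.conj hp (V k) (adjoint (W k))).sub hp (hBm.conj hp V₀ (adjoint W₀)))
  have := hconj (hV1 k) (hW1 k)
  have := hconj hV₀ hW₀
  linarith

end Approximation

section Atomless

variable {X : Type*} [MeasurableSpace X] {μ : Measure X} {s : Set X}

lemma Atomless.exists_subset_measure_le_half (hμ : Atomless μ) (hs : MeasurableSet s)
    (hs0 : μ s ≠ 0) : ∃ t ⊆ s, MeasurableSet t ∧ μ t ≠ 0 ∧ μ t ≤ 2⁻¹ * μ s := by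
  obtain ⟨t, hts, ht, h0, h0'⟩ := hμ s hs hs0
  have hsum : μ t + μ (s \ t) = μ s := by
    rw [← measure_inter_add_sdiff s ht, Set.inter_eq_self_of_subset_right hts]
  have hhalf : μ t ≤ 2⁻¹ * μ s ∨ μ (s \ t) ≤ 2⁻¹ * μ s := by
    by_contra! hcon
    have hlt := ENNReal.add_lt_add hcon.1 hcon.2
    rw [hsum, ← add_mul, ENNReal.inv_two_add_inv_two, one_mul] at hlt
    exact hlt.false
  exact hhalf.elim (fun h => ⟨t, hts, ht, h0, h⟩)
    fun h => ⟨s \ t, Set.sdiff_subset, hs.diff ht, h0', h⟩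

lemma Atomless.exists_subset_measure_le (hμ : Atomless μ) (hs : MeasurableSet s)
    (hs0 : μ s ≠ 0) (hsfin : μ s ≠ ∞) {ε : ℝ≥0∞} (hε : ε ≠ 0) :
    ∃ t ⊆ s, MeasurableSet t ∧ μ t ≠ 0 ∧ μ t ≤ ε := by
  have hpow : ∀ n : ℕ, ∃ t ⊆ s, MeasurableSet t ∧ μ t ≠ 0 ∧ μ t ≤ (2⁻¹ : ℝ≥0∞) ^ n * μ s := by
    intro n
    induction n with
    | zero => exact ⟨s, subset_rfl, hs, hs0, by simp⟩
    | succ n ih =>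
      obtain ⟨t, hts, ht, ht0, htle⟩ := ih
      obtain ⟨t', ht't, ht', ht'0, ht'le⟩ := hμ.exists_subset_measure_le_half ht ht0
      refine ⟨t', ht't.trans hts, ht', ht'0, ht'le.trans ?_⟩
      rw [pow_succ', mul_assoc]
      gcongr
  have hlim : Tendsto (fun n : ℕ => (2⁻¹ : ℝ≥0∞) ^ n * μ s) atTop (𝓝 0) := by
    simpa only [zero_mul] using ENNReal.Tendsto.mul_const (b := μ s)
      (ENNReal.tendsto_pow_atTop_nhds_zero_of_lt_one (r := 2⁻¹) (by simp)) (Or.inr hsfin)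
  obtain ⟨n, hn⟩ := (hlim.eventually_lt_const (pos_iff_ne_zero.mpr hε)).exists
  obtain ⟨t, hts, ht, ht0, htle⟩ := hpow n
  exact ⟨t, hts, ht, ht0, htle.trans hn.le⟩

lemma exists_superset_measureReal_le_add {P : Set X → Prop} {c : ℝ} (hc : ∀ D, P D → μ.real D ≤ c)
    {D : Set X} (hD : P D) {ε : ℝ} (hε : 0 < ε) :
    ∃ D', P D' ∧ D ⊆ D' ∧ ∀ D'', P D'' → D ⊆ D'' → μ.real D'' ≤ μ.real D' + ε := by
  let M := μ.real '' {D' | P D' ∧ D ⊆ D'}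
  have hbdd : BddAbove M := ⟨c, Set.forall_mem_image.mpr fun D' h => hc D' h.1⟩
  obtain ⟨_, ⟨D', ⟨hD', hDD'⟩, rfl⟩, hlt⟩ :=
    exists_lt_of_lt_csSup (⟨_, D, ⟨hD, subset_rfl⟩, rfl⟩ : M.Nonempty) (sub_lt_self (sSup M) hε)
  refine ⟨D', hD', hDD', fun D'' hD'' hDD'' => ?_⟩
  linarith [le_csSup hbdd ⟨D'', ⟨hD'', hDD''⟩, rfl⟩]

/-- Exhaustion: enlarge a set greedily, at step `n` up to `1 / (n + 1)` of the largest possible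
measure, and take the union. -/
lemma exists_maximal_measure {P : Set X → Prop} {c : ℝ≥0∞} (hc : c ≠ ∞) (hempty : P ∅)
    (hunion : ∀ D : ℕ → Set X, Monotone D → (∀ n, P (D n)) → P (⋃ n, D n))
    (hle : ∀ D, P D → μ D ≤ c) : ∃ U, P U ∧ ∀ D, P D → U ⊆ D → μ D ≤ μ U := by
  have hfin : ∀ {D}, P D → μ D ≠ ∞ := fun hD => ne_top_of_le_ne_top hc (hle _ hD)
  have hnext : ∀ (n : ℕ) (D : Subtype P), ∃ D' : Subtype P, D.1 ⊆ D'.1 ∧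
      ∀ D'', P D'' → D.1 ⊆ D'' → μ.real D'' ≤ μ.real D'.1 + 1 / ((n : ℝ) + 1) := by
    intro n D
    obtain ⟨D', hD', hsub, hmax⟩ := exists_superset_measureReal_le_add
      (fun D hD => ENNReal.toReal_mono hc (hle D hD)) D.2 (Nat.one_div_pos_of_nat (n := n) (α := ℝ))
    exact ⟨⟨D', hD'⟩, hsub, hmax⟩
  choose next hsub hmax using hnext
  let D : ℕ → Subtype P := fun n => Nat.rec ⟨∅, hempty⟩ next n
  have hPU : P (⋃ n, (D n).1) :=
    hunion _ (monotone_nat_of_le_succ fun n => hsub n (D n)) fun n => (D n).2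
  refine ⟨_, hPU, fun D' hD' hUD' => ?_⟩
  rw [← ENNReal.toReal_le_toReal (hfin hD') (hfin hPU)]
  refine le_of_forall_pos_le_add fun ε hε => ?_
  obtain ⟨n, hn⟩ := exists_nat_one_div_lt hε
  calc μ.real D' ≤ μ.real (D (n + 1)).1 + 1 / ((n : ℝ) + 1) :=
        hmax n (D n) D' hD' ((Set.subset_iUnion (fun n => (D n).1) n).trans hUD')
    _ ≤ μ.real (⋃ n, (D n).1) + ε :=
        add_le_add (measureReal_mono (Set.subset_iUnion (fun n => (D n).1) (n + 1)) (hfin hPU))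
          hn.le

lemma Atomless.exists_subset_measure_eq (hμ : Atomless μ) (hs : MeasurableSet s)
    (hsfin : μ s ≠ ∞) {c : ℝ≥0∞} (hc : c ≤ μ s) : ∃ t ⊆ s, MeasurableSet t ∧ μ t = c := by
  obtain ⟨U, ⟨hUs, hU, hUc⟩, hmax⟩ :=
    exists_maximal_measure (μ := μ) (P := fun D => D ⊆ s ∧ MeasurableSet D ∧ μ D ≤ c)
      (ne_top_of_le_ne_top hsfin hc) ⟨Set.empty_subset _, MeasurableSet.empty, by simp⟩
      (fun D hD h => ⟨Set.iUnion_subset fun n => (h n).1, MeasurableSet.iUnion fun n => (h n).2.1,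
        hD.measure_iUnion.trans_le (iSup_le fun n => (h n).2.2)⟩) fun D h => h.2.2
  refine ⟨U, hUs, hU, hUc.eq_of_not_lt fun hlt => ?_⟩
  have hUfin : μ U ≠ ∞ := hlt.ne_top
  have hdiff : μ (s \ U) ≠ 0 := by
    rw [measure_sdiff hUs hU.nullMeasurableSet hUfin]
    exact (tsub_pos_of_lt (hlt.trans_le hc)).ne'
  obtain ⟨E, hEs, hE, hE0, hEle⟩ := hμ.exists_subset_measure_le (hs.diff hU) hdiff
    (measure_ne_top_of_subset Set.sdiff_subset hsfin) (tsub_pos_of_lt hlt).ne'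
  have hmeas : μ (U ∪ E) = μ U + μ E :=
    measure_union (Set.disjoint_sdiff_right.mono_right hEs) hE
  have hUE : μ (U ∪ E) ≤ c := by
    rw [hmeas, ← add_tsub_cancel_of_le hlt.le]
    gcongr
  have hle := hmax (U ∪ E) ⟨Set.union_subset hUs (hEs.trans Set.sdiff_subset), hU.union hE, hUE⟩
    Set.subset_union_left
  rw [hmeas] at hle
  exact hle.not_gt (ENNReal.lt_add_right hUfin hE0)

lemma Atomless.exists_half (hμ : Atomless μ) (hs : MeasurableSet s) (hsfin : μ s ≠ ∞) :
    ∃ t ⊆ s, MeasurableSet t ∧ μ.real t = μ.real (s \ t) := by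
  obtain ⟨t, hts, ht, h⟩ := hμ.exists_subset_measure_eq hs hsfin (c := μ s / 2) ENNReal.half_le_self
  refine ⟨t, hts, ht, ?_⟩
  rw [measureReal_sdiff hts ht hsfin, measureReal_def, measureReal_def, h, ENNReal.toReal_div,
    ENNReal.toReal_ofNat]
  ring

end Atomless

section SignFunctions

variable {X : Type*} {D : Set X}

open Classical in
/-- The function equal to `1` on `D` and to `-1` off `D`. -/
def signFn (D : Set X) (x : X) : ℂ := if x ∈ D then 1 else -1

lemma signFn_of_mem {x : X} (hx : x ∈ D) : signFn D x = 1 := if_pos hx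

lemma signFn_of_notMem {x : X} (hx : x ∉ D) : signFn D x = -1 := if_neg hx

lemma signFn_congr {D' : Set X} {x : X} (h : x ∈ D ↔ x ∈ D') : signFn D x = signFn D' x := by
  unfold signFn; split_ifs <;> tauto

lemma norm_signFn (D : Set X) (x : X) : ‖signFn D x‖ = 1 := by
  unfold signFn; split_ifs <;> simp

lemma signFn_mul_self (D : Set X) (x : X) : signFn D x * signFn D x = 1 := by
  unfold signFn; split_ifs <;> simp

lemma conj_signFn (D : Set X) (x : X) : (starRingEnd ℂ) (signFn D x) = signFn D x := by
  unfold signFn; split_ifs <;> simp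

variable {E : Type*} [NormedAddCommGroup E] [NormedSpace ℂ E]

lemma enorm_signFn_smul (D : Set X) (x : X) (c : E) : ‖signFn D x • c‖ₑ = ‖c‖ₑ := by
  rw [enorm_smul, ← ofReal_norm (signFn D x), norm_signFn, ENNReal.ofReal_one, one_mul]

variable [MeasurableSpace X] {μ : Measure X}

lemma measurable_signFn (hD : MeasurableSet D) : Measurable (signFn D) :=
  Measurable.ite hD measurable_const measurable_const

lemma integrable_signFn_smul (hD : MeasurableSet D) {f : X → E} (hf : Integrable f μ) :
    Integrable (fun x => signFn D x • f x) μ :=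
  hf.bdd_smul 1 (measurable_signFn hD).aestronglyMeasurable
    (Eventually.of_forall fun x => (norm_signFn D x).le)

lemma Atomless.exists_signFn_integral_indicator_eq_zero [CompleteSpace E] (hμ : Atomless μ)
    {s : Set X} (hs : MeasurableSet s) (c : E) (hint : Integrable (s.indicator fun _ => c) μ) :
    ∃ D, MeasurableSet D ∧ ∫ x, signFn D x • s.indicator (fun _ => c) x ∂μ = 0 := by
  obtain rfl | hc := eq_or_ne c 0
  · exact ⟨∅, MeasurableSet.empty, by simp⟩
  have hsfin : μ s ≠ ∞ := by
    simpa [integrableOn_const_iff, hc, lt_top_iff_ne_top] using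
      (integrable_indicator_iff hs).mp hint
  obtain ⟨t, hts, ht, hhalf⟩ := hμ.exists_half hs hsfin
  refine ⟨t, ht, ?_⟩
  have hsplit : ∀ x, signFn t x • s.indicator (fun _ => c) x =
      t.indicator (fun _ => c) x - (s \ t).indicator (fun _ => c) x := by
    intro x
    by_cases hxt : x ∈ t
    · simp [signFn_of_mem hxt, hxt, hts hxt]
    · by_cases hxs : x ∈ s <;> simp [signFn_of_notMem hxt, hxt, hxs]
  have hind : ∀ u ⊆ s, MeasurableSet u → Integrable (u.indicator fun _ => c) μ := fun u hus hu =>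
    (integrable_indicator_iff hu).mpr (integrableOn_const (measure_ne_top_of_subset hus hsfin))
  simp_rw [hsplit]
  rw [integral_sub (hind t hts ht) (hind _ Set.sdiff_subset (hs.diff ht)),
    integral_indicator_const _ ht, integral_indicator_const _ (hs.diff ht), hhalf, sub_self]

lemma Atomless.exists_signFn_integral_simpleFunc_eq_zero [CompleteSpace E] (hμ : Atomless μ)
    (g : SimpleFunc X E) (hg : Integrable g μ) :
    ∃ D, MeasurableSet D ∧ ∫ x, signFn D x • g x ∂μ = 0 := by
  induction g using SimpleFunc.induction with
  | const c hs =>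
    classical
    simp only [SimpleFunc.coe_piecewise, SimpleFunc.coe_const, Function.const_zero,
      Set.piecewise_eq_indicator] at hg ⊢
    exact hμ.exists_signFn_integral_indicator_eq_zero hs c hg
  | @add f g hdisj ihf ihg =>
    rw [SimpleFunc.coe_add, integrable_add_of_disjoint hdisj f.stronglyMeasurable
      g.stronglyMeasurable] at hg
    obtain ⟨Df, hDf, hf0⟩ := ihf hg.1
    obtain ⟨Dg, hDg, hg0⟩ := ihg hg.2
    let s := Function.support f
    have hs : MeasurableSet s := f.measurableSet_support
    let D := Df ∩ s ∪ Dg \ s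
    have hD : MeasurableSet D := (hDf.inter hs).union (hDg.diff hs)
    have hDfs : ∀ x ∈ s, signFn D x = signFn Df x := fun x hx =>
      signFn_congr (by simp [D, hx])
    have hDgs : ∀ x ∉ s, signFn D x = signFn Dg x := fun x hx =>
      signFn_congr (by simp [D, hx])
    refine ⟨D, hD, ?_⟩
    have hsum : ∀ x, signFn D x • (f + g) x = signFn Df x • f x + signFn Dg x • g x := by
      intro x
      by_cases hx : x ∈ s
      · have hgx : g x = 0 := Function.notMem_support.mp (Set.disjoint_left.mp hdisj hx)
        rw [SimpleFunc.coe_add, Pi.add_apply, hgx, hDfs x hx, add_zero, smul_zero, add_zero]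
      · rw [SimpleFunc.coe_add, Pi.add_apply, Function.notMem_support.mp hx, hDgs x hx, zero_add,
          smul_zero, zero_add]
    simp_rw [hsum]
    rw [integral_add (integrable_signFn_smul hDf hg.1) (integrable_signFn_smul hDg hg.2), hf0, hg0,
      add_zero]

lemma Atomless.exists_signFn_norm_integral_lt [CompleteSpace E] (hμ : Atomless μ) {h : X → E}
    (hh : Integrable h μ) {ε : ℝ} (hε : 0 < ε) :
    ∃ D, MeasurableSet D ∧ ‖∫ x, signFn D x • h x ∂μ‖ < ε := by
  obtain ⟨g, hhg, hg⟩ := (memLp_one_iff_integrable.mpr hh).exists_simpleFunc_eLpNorm_sub_lt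
    ENNReal.one_ne_top (ε := ENNReal.ofReal ε) (ENNReal.ofReal_pos.mpr hε).ne'
  have hgi : Integrable g μ := memLp_one_iff_integrable.mp hg
  obtain ⟨D, hD, hint⟩ := hμ.exists_signFn_integral_simpleFunc_eq_zero g hgi
  refine ⟨D, hD, (ENNReal.ofReal_lt_ofReal_iff hε).mp ?_⟩
  calc ENNReal.ofReal ‖∫ x, signFn D x • h x ∂μ‖
      = ‖∫ x, signFn D x • (h - ⇑g) x ∂μ‖ₑ := by
        simp_rw [Pi.sub_apply, smul_sub]
        rw [integral_sub (integrable_signFn_smul hD hh) (integrable_signFn_smul hD hgi), hint,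
          sub_zero, ofReal_norm]
    _ ≤ ∫⁻ x, ‖signFn D x • (h - ⇑g) x‖ₑ ∂μ := enorm_integral_le_lintegral_enorm _
    _ = eLpNorm (h - ⇑g) 1 μ := by simp_rw [enorm_signFn_smul, eLpNorm_one_eq_lintegral_enorm]
    _ < ENNReal.ofReal ε := hhg

end SignFunctions

section SignMul

variable {X : Type*} [MeasurableSpace X] {μ : Measure X}

lemma memLp_top_signFn {D : Set X} (hD : MeasurableSet D) : MemLp (signFn D) ∞ μ :=
  memLp_top_of_bound (measurable_signFn hD).aestronglyMeasurable 1
    (Eventually.of_forall fun x => (norm_signFn D x).le)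

/-- Multiplication by `signFn D` on `L²`. -/
def signMul (μ : Measure X) {D : Set X} (hD : MeasurableSet D) : Lp ℂ 2 μ →L[ℂ] Lp ℂ 2 μ :=
  (ContinuousLinearMap.lsmul ℂ ℂ).holderL μ ∞ 2 2 (memLp_top_signFn hD).toLp

lemma coeFn_signMul {D : Set X} (hD : MeasurableSet D) (f : Lp ℂ 2 μ) :
    signMul μ hD f =ᵐ[μ] fun x => signFn D x * f x := by
  refine (ContinuousLinearMap.coeFn_holder _ _ _).trans ?_
  filter_upwards [(memLp_top_signFn (μ := μ) hD).coeFn_toLp] with x hx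
  simp [hx]

lemma norm_signMul_le {D : Set X} (hD : MeasurableSet D) : ‖signMul μ hD‖ ≤ 1 := by
  refine ContinuousLinearMap.opNorm_le_bound _ zero_le_one fun f => ?_
  rw [one_mul]
  refine Lp.norm_le_norm_of_ae_le ?_
  filter_upwards [coeFn_signMul hD f] with x hx
  rw [hx, norm_mul, norm_signFn, one_mul]

lemma signMul_signMul {D : Set X} (hD : MeasurableSet D) (f : Lp ℂ 2 μ) :
    signMul μ hD (signMul μ hD f) = f := by
  refine Lp.ext ?_
  filter_upwards [coeFn_signMul hD f, coeFn_signMul hD (signMul μ hD f)] with x h1 h2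
  rw [h2, h1, ← mul_assoc, signFn_mul_self, one_mul]

lemma inner_signMul_left {D : Set X} (hD : MeasurableSet D) (f g : Lp ℂ 2 μ) :
    inner ℂ (signMul μ hD f) g = ∫ x, signFn D x • inner ℂ (f x) (g x) ∂μ := by
  rw [L2.inner_def]
  refine integral_congr_ae ?_
  filter_upwards [coeFn_signMul hD f] with x hx
  rw [hx, RCLike.inner_apply, RCLike.inner_apply, map_mul, conj_signFn, smul_eq_mul]
  ring

lemma isSelfAdjoint_signMul {D : Set X} (hD : MeasurableSet D) :
    IsSelfAdjoint (signMul μ hD) := by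
  refine ContinuousLinearMap.isSelfAdjoint_iff_isSymmetric.mpr fun f g => ?_
  change inner ℂ (signMul μ hD f) g = inner ℂ f (signMul μ hD g)
  rw [inner_signMul_left, ← inner_conj_symm, inner_signMul_left, ← integral_conj]
  simp_rw [smul_eq_mul, map_mul, conj_signFn, inner_conj_symm]

lemma Atomless.exists_norm_inner_signMul_lt (hμ : Atomless μ) {K : Type*} [Finite K]
    (f g : K → Lp ℂ 2 μ) {ε : ℝ} (hε : 0 < ε) :
    ∃ (D : Set X) (hD : MeasurableSet D), ∀ k, ‖inner ℂ (signMul μ hD (f k)) (g k)‖ < ε := by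
  cases nonempty_fintype K
  have hint : Integrable (fun x (k : K) => (inner ℂ (f k x) (g k x) : ℂ)) μ :=
    Integrable.of_eval fun k => L2.integrable_inner (f k) (g k)
  obtain ⟨D, hD, hlt⟩ := hμ.exists_signFn_norm_integral_lt hint hε
  refine ⟨D, hD, fun k => lt_of_le_of_lt ?_ hlt⟩
  refine le_trans (le_of_eq ?_) (norm_le_pi_norm _ k)
  rw [inner_signMul_left, eval_integral (integrable_signFn_smul hD hint).eval]
  rfl

lemma Atomless.exists_seq_signMul (hμ : Atomless μ) (S : Finset (Lp ℂ 2 μ)) {ε : ℝ} (hε : 0 < ε) :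
    ∃ (D : ℕ → Set X) (hD : ∀ n, MeasurableSet (D n)), Pairwise fun m n =>
      ∀ f ∈ S, ∀ g ∈ S, ‖inner ℂ (signMul μ (hD m) f) (signMul μ (hD n) g)‖ < ε := by
  let r : (Lp ℂ 2 μ →L[ℂ] Lp ℂ 2 μ) → (Lp ℂ 2 μ →L[ℂ] Lp ℂ 2 μ) → Prop :=
    fun R R' => ∀ f ∈ S, ∀ g ∈ S, ‖inner ℂ (R f) (R' g)‖ < ε
  have : Std.Symm r := ⟨fun R R' h f hf g hg => by rw [norm_inner_symm]; exact h g hg f hf⟩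
  obtain ⟨R, hR, hr⟩ := exists_seq_of_forall_finset_exists'
    (fun R => ∃ (D : Set X) (hD : MeasurableSet D), R = signMul μ hD) r fun s _ => by
      obtain ⟨D, hD, hlt⟩ := hμ.exists_norm_inner_signMul_lt
        (fun k : s × S × S => k.2.1) (fun k => k.1.1 k.2.2) hε
      refine ⟨_, ⟨D, hD, rfl⟩, fun R hR f hf g hg => ?_⟩
      rw [norm_inner_symm]
      exact hlt ⟨⟨R, hR⟩, ⟨g, hg⟩, ⟨f, hf⟩⟩
  choose D hD hRD using hR
  obtain rfl : R = fun n => signMul μ (hD n) := funext hRD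
  exact ⟨D, hD, hr⟩

end SignMul

section Kernel

variable {X : Type*} [MeasurableSpace X] {μ : Measure X}

lemma eLpNorm_two_sq {Y : Type*} [MeasurableSpace Y] {ν : Measure Y} (f : Y → ℂ) :
    eLpNorm f 2 ν ^ 2 = ∫⁻ y, ‖f y‖ₑ ^ 2 ∂ν := by
  have := eLpNorm_nnreal_pow_eq_lintegral (f := f) (μ := ν) (p := 2) two_ne_zero
  simpa using this

lemma enorm_integral_mul_le {g f : X → ℂ} (hg : AEStronglyMeasurable g μ)
    (hf : AEStronglyMeasurable f μ) :
    ‖∫ y, g y * f y ∂μ‖ₑ ≤ eLpNorm g 2 μ * eLpNorm f 2 μ := by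
  have hL1 : ‖∫ y, g y * f y ∂μ‖ₑ ≤ eLpNorm (g • f) 1 μ := by
    rw [eLpNorm_one_eq_lintegral_enorm]
    exact enorm_integral_le_lintegral_enorm _
  exact hL1.trans (eLpNorm_smul_le_mul_eLpNorm hf hg)

lemma HasKernel.signMul_conj {B : Lp ℂ 2 μ →L[ℂ] Lp ℂ 2 μ} {k : X × X → ℂ}
    (hB : HasKernel μ B k) {D D' : Set X} (hD : MeasurableSet D) (hD' : MeasurableSet D') :
    HasKernel μ (signMul μ hD ∘L B ∘L signMul μ hD')
      (fun z => signFn D z.1 * signFn D' z.2 * k z) := by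
  refine ⟨hB.1.of_le ?_ (Eventually.of_forall fun z => ?_), fun f => ?_⟩
  · exact ((((measurable_signFn hD).comp measurable_fst).mul
      ((measurable_signFn hD').comp measurable_snd)).aestronglyMeasurable).mul hB.1.1
  · rw [norm_mul, norm_mul, norm_signFn, norm_signFn, one_mul, one_mul]
  · filter_upwards [coeFn_signMul hD (B (signMul μ hD' f)), hB.2 (signMul μ hD' f)] with x h1 h2
    rw [ContinuousLinearMap.comp_apply, ContinuousLinearMap.comp_apply, h1, h2,
      ← integral_const_mul]
    refine integral_congr_ae ?_
    filter_upwards [coeFn_signMul hD' f] with y hy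
    rw [hy]
    ring

variable [SFinite μ]
lemma memLp_slice {k : X × X → ℂ} (hk : MemLp k 2 (μ.prod μ)) :
    ∀ᵐ x ∂μ, MemLp (fun y => k (x, y)) 2 μ := by
  have hsq := (memLp_two_iff_integrable_sq_norm hk.1).mp hk
  filter_upwards [hk.1.prodMk_left, hsq.prod_right_ae] with x hmeas hint
  exact (memLp_two_iff_integrable_sq_norm hmeas).mpr hint

lemma lintegral_slice {k : X × X → ℂ} (hk : MemLp k 2 (μ.prod μ)) :
    ∫⁻ x, eLpNorm (fun y => k (x, y)) 2 μ ^ 2 ∂μ = eLpNorm k 2 (μ.prod μ) ^ 2 := by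
  simp_rw [eLpNorm_two_sq]
  exact (lintegral_prod _ (hk.1.enorm.pow_const 2)).symm

lemma eLpNorm_integral_kernel_le {k : X × X → ℂ} (hk : MemLp k 2 (μ.prod μ)) {f : X → ℂ}
    (hf : MemLp f 2 μ) : eLpNorm (fun x => ∫ y, k (x, y) * f y ∂μ) 2 μ ≤
      eLpNorm k 2 (μ.prod μ) * eLpNorm f 2 μ := by
  have h : eLpNorm (fun x => ∫ y, k (x, y) * f y ∂μ) 2 μ ^ 2 ≤
      (eLpNorm k 2 (μ.prod μ) * eLpNorm f 2 μ) ^ 2 := by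
    rw [eLpNorm_two_sq, mul_pow, ← lintegral_slice hk,
      ← lintegral_mul_const' _ _ (ENNReal.pow_ne_top hf.2.ne)]
    refine lintegral_mono_ae ?_
    filter_upwards [hk.1.prodMk_left] with x hx
    rw [← mul_pow]
    exact pow_le_pow_left' (enorm_integral_mul_le hx hf.1) 2
  exact (ENNReal.pow_le_pow_left_iff two_ne_zero).mp h

lemma memLp_integral_kernel {k : X × X → ℂ} (hk : MemLp k 2 (μ.prod μ)) {f : X → ℂ}
    (hf : MemLp f 2 μ) : MemLp (fun x => ∫ y, k (x, y) * f y ∂μ) 2 μ :=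
  ⟨(hk.1.mul hf.1.comp_snd).integral_prod_right',
    (eLpNorm_integral_kernel_le hk hf).trans_lt (ENNReal.mul_lt_top hk.2 hf.2)⟩
lemma integral_kernel_add {k : X × X → ℂ} (hk : MemLp k 2 (μ.prod μ)) (f g : Lp ℂ 2 μ) :
    (fun x => ∫ y, k (x, y) * (f + g) y ∂μ) =ᵐ[μ]
      fun x => ∫ y, k (x, y) * f y ∂μ + ∫ y, k (x, y) * g y ∂μ := by
  filter_upwards [memLp_slice hk] with x hx
  rw [← integral_add (f := fun y => k (x, y) * f y) (g := fun y => k (x, y) * g y)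
    (hx.integrable_mul (Lp.memLp f)) (hx.integrable_mul (Lp.memLp g))]
  refine integral_congr_ae ?_
  filter_upwards [Lp.coeFn_add f g] with y hy
  rw [hy, Pi.add_apply, mul_add]

omit [SFinite μ] in
lemma integral_kernel_smul (k : X × X → ℂ) (c : ℂ) (f : Lp ℂ 2 μ) (x : X) :
    ∫ y, k (x, y) * (c • f) y ∂μ = c • ∫ y, k (x, y) * f y ∂μ := by
  rw [← integral_smul]
  refine integral_congr_ae ?_
  filter_upwards [Lp.coeFn_smul c f] with y hy
  rw [hy, Pi.smul_apply, smul_eq_mul, smul_eq_mul]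
  ring

lemma exists_hasKernel {k : X × X → ℂ} (hk : MemLp k 2 (μ.prod μ)) :
    ∃ B : Lp ℂ 2 μ →L[ℂ] Lp ℂ 2 μ, HasKernel μ B k := by
  have hcoe : ∀ f : Lp ℂ 2 μ, (memLp_integral_kernel hk (Lp.memLp f)).toLp =ᵐ[μ]
      fun x => ∫ y, k (x, y) * f y ∂μ := fun f => MemLp.coeFn_toLp _
  let L : Lp ℂ 2 μ →ₗ[ℂ] Lp ℂ 2 μ :=
    { toFun := fun f => (memLp_integral_kernel hk (Lp.memLp f)).toLp
      map_add' := fun f g => by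
        refine Lp.ext ((hcoe (f + g)).trans ((integral_kernel_add hk f g).trans ?_))
        exact ((hcoe f).add (hcoe g)).symm.trans (Lp.coeFn_add _ _).symm
      map_smul' := fun c f => by
        refine Lp.ext ((hcoe (c • f)).trans ?_)
        simp_rw [integral_kernel_smul]
        exact ((hcoe f).const_smul c).symm.trans (Lp.coeFn_smul _ _).symm }
  refine ⟨L.mkContinuous (eLpNorm k 2 (μ.prod μ)).toReal fun f => ?_, hk, hcoe⟩
  change ‖(memLp_integral_kernel hk (Lp.memLp f)).toLp‖ ≤ _
  rw [Lp.norm_toLp, Lp.norm_def, ← ENNReal.toReal_mul]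
  exact ENNReal.toReal_mono (ENNReal.mul_ne_top hk.2.ne (Lp.memLp f).2.ne)
    (eLpNorm_integral_kernel_le hk (Lp.memLp f))

omit [SFinite μ] in
lemma hasKernel_rankOne (f g : Lp ℂ 2 μ) :
    HasKernel μ (rankOne ℂ f g) (fun z => f z.1 * (starRingEnd ℂ) (g z.2)) := by
  have hm : AEStronglyMeasurable (fun z : X × X => f z.1 * (starRingEnd ℂ) (g z.2))
      (μ.prod μ) :=
    (Lp.memLp f).1.comp_fst.mul
      (Complex.continuous_conj.comp_aestronglyMeasurable (Lp.memLp g).1.comp_snd)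
  refine ⟨?_, fun h => ?_⟩
  · rw [memLp_two_iff_integrable_sq_norm hm]
    have hf := (memLp_two_iff_integrable_sq_norm (Lp.memLp f).1).mp (Lp.memLp f)
    have hg := (memLp_two_iff_integrable_sq_norm (Lp.memLp g).1).mp (Lp.memLp g)
    refine (hf.mul_prod hg).congr (Eventually.of_forall fun z => ?_)
    simp only [norm_mul, RCLike.norm_conj, mul_pow]
  · rw [rankOne_apply]
    filter_upwards [Lp.coeFn_smul (inner ℂ g h) f] with x hx
    rw [hx, Pi.smul_apply, L2.inner_def, smul_eq_mul, mul_comm, ← integral_const_mul]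
    refine integral_congr_ae (Eventually.of_forall fun y => ?_)
    simp only [RCLike.inner_apply]
    ring

variable {p : ℝ≥0∞} {φ : X × X → ℂ}
  {T : (Lp ℂ 2 μ →L[ℂ] Lp ℂ 2 μ) → (Lp ℂ 2 μ →L[ℂ] Lp ℂ 2 μ)}

lemma ExtendsSchur.map_signMul_rankOne (hT : ExtendsSchur μ p φ T) (hp : 1 ≤ p)
    (hφ : MemLp φ ∞ (μ.prod μ)) {D D' : Set X} (hD : MeasurableSet D) (hD' : MeasurableSet D')
    (f g : Lp ℂ 2 μ) :
    T (signMul μ hD ∘L rankOne ℂ f g ∘L signMul μ hD') =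
      signMul μ hD ∘L T (rankOne ℂ f g) ∘L signMul μ hD' := by
  have hk := hasKernel_rankOne f g
  obtain ⟨B, hB⟩ := exists_hasKernel (hk.1.mul (r := 2) hφ)
  have h2 : (1 : ℝ≥0∞) ≤ 2 := by norm_num
  rw [hT _ B _ (memSchatten_rankOne h2 f g) (memSchatten_rankOne hp f g) hk hB]
  refine hT _ _ _ ((memSchatten_rankOne h2 f g).conj h2 _ _)
    ((memSchatten_rankOne hp f g).conj hp _ _) (hk.signMul_conj hD hD') ?_
  convert hB.signMul_conj hD hD' using 2 with z
  simp only [Pi.mul_apply]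
  ring

end Kernel

section Bounded

variable {H : Type*} [NormedAddCommGroup H] [InnerProductSpace ℂ H] [CompleteSpace H]
  {p : ℝ≥0∞} {C : ℝ≥0} {T : (H →L[ℂ] H) → (H →L[ℂ] H)}

lemma IsBoundedOnSchatten.schattenReal_le (hT : IsBoundedOnSchatten p C T) (hp : 1 ≤ p)
    {A : H →L[ℂ] H} (hA : MemSchatten p A) :
    schattenReal p (T A) ≤ C * schattenReal p A := by
  have h := ENNReal.toReal_mono
    (ENNReal.mul_ne_top ENNReal.coe_ne_top (hA.schattenNorm_ne_top hp)) (hT.bound A hA)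
  rwa [ENNReal.toReal_mul, ENNReal.coe_toReal] at h

lemma isBoundedOnSchatten_of_schattenReal (hp : 1 ≤ p)
    (mapsTo : ∀ A, MemSchatten p A → MemSchatten p (T A))
    (map_add : ∀ A B, MemSchatten p A → MemSchatten p B → T (A + B) = T A + T B)
    (map_smul : ∀ (c : ℂ) A, MemSchatten p A → T (c • A) = c • T A)
    (bound : ∀ A, MemSchatten p A → schattenReal p (T A) ≤ C * schattenReal p A) :
    IsBoundedOnSchatten p C T where
  mapsTo := mapsTo
  map_add := map_add
  map_smul := map_smul
  bound A hA := by
    rw [← (mapsTo A hA).ofReal_schattenReal hp, ← hA.ofReal_schattenReal hp,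
      ← ENNReal.ofReal_coe_nnreal, ← ENNReal.ofReal_mul C.coe_nonneg]
    exact ENNReal.ofReal_le_ofReal (bound A hA)

lemma IsBoundedOnSchatten.map_sub (hT : IsBoundedOnSchatten p C T) (hp : 1 ≤ p)
    {A B : H →L[ℂ] H} (hA : MemSchatten p A) (hB : MemSchatten p B) : T (A - B) = T A - T B := by
  rw [sub_eq_add_neg, ← neg_one_smul ℂ B, hT.map_add _ _ hA (hB.smul hp _), hT.map_smul _ _ hB,
    neg_one_smul, sub_eq_add_neg]

lemma IsBoundedOnSchatten.map_zero (hT : IsBoundedOnSchatten p C T) (hp : 1 ≤ p) : T 0 = 0 := by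
  simpa only [zero_smul] using hT.map_smul 0 0 (memSchatten_zero hp)

lemma IsBoundedOnSchatten.map_sum (hT : IsBoundedOnSchatten p C T) (hp : 1 ≤ p) {ι : Type*}
    (s : Finset ι) {A : ι → H →L[ℂ] H} (hA : ∀ i, MemSchatten p (A i)) :
    T (∑ i ∈ s, A i) = ∑ i ∈ s, T (A i) := by
  classical
  induction s using Finset.induction_on with
  | empty => simpa only [Finset.sum_empty] using hT.map_zero hp
  | insert i s hi ih =>
    rw [Finset.sum_insert hi, Finset.sum_insert hi, hT.map_add _ _ (hA i)
      (MemSchatten.sum hp s fun j _ => hA j), ih]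

lemma IsBoundedOnSchatten.norm_map_le (hT : IsBoundedOnSchatten p C T) (hp : 1 ≤ p)
    {A : H →L[ℂ] H} (hA : MemSchatten p A) : ‖T A‖ ≤ C * schattenReal p A :=
  ((hT.mapsTo A hA).norm_le hp).trans (hT.schattenReal_le hp hA)

lemma IsBoundedOnSchatten.map_conj_of_mem_finiteRank (hT : IsBoundedOnSchatten p C T)
    (hp : 1 ≤ p) {V W : H →L[ℂ] H}
    (h : ∀ ξ η, T (V ∘L rankOne ℂ ξ η ∘L W) = V ∘L T (rankOne ℂ ξ η) ∘L W)
    {B : H →L[ℂ] H} (hB : B ∈ finiteRank H) : T (V ∘L B ∘L W) = V ∘L T B ∘L W := by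
  induction hB using Submodule.span_induction with
  | mem B hB => obtain ⟨ξη, rfl⟩ := hB; exact h _ _
  | zero =>
    simp only [ContinuousLinearMap.zero_comp, ContinuousLinearMap.comp_zero, hT.map_zero hp]
  | add B D hB hD ihB ihD =>
    have hBm := memSchatten_of_mem_finiteRank hp hB
    have hDm := memSchatten_of_mem_finiteRank hp hD
    rw [ContinuousLinearMap.add_comp, ContinuousLinearMap.comp_add,
      hT.map_add _ _ (hBm.conj hp V W) (hDm.conj hp V W), ihB, ihD, hT.map_add _ _ hBm hDm,
      ContinuousLinearMap.add_comp, ContinuousLinearMap.comp_add]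
  | smul c B hB ihB =>
    have hBm := memSchatten_of_mem_finiteRank hp hB
    rw [ContinuousLinearMap.smul_comp, ContinuousLinearMap.comp_smul,
      hT.map_smul _ _ (hBm.conj hp V W), ihB, hT.map_smul _ _ hBm,
      ContinuousLinearMap.smul_comp, ContinuousLinearMap.comp_smul]

omit [CompleteSpace H] in
lemma norm_comp_comp_le_of_le {V W : H →L[ℂ] H} (hV : ‖V‖ ≤ 1) (hW : ‖W‖ ≤ 1) (A : H →L[ℂ] H) :
    ‖V ∘L A ∘L W‖ ≤ ‖A‖ :=
  calc ‖V ∘L A ∘L W‖ ≤ ‖V‖ * (‖A‖ * ‖W‖) := (ContinuousLinearMap.opNorm_comp_le _ _).trans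
        (by gcongr; exact ContinuousLinearMap.opNorm_comp_le _ _)
    _ ≤ 1 * (‖A‖ * 1) := by gcongr
    _ = ‖A‖ := by ring

lemma IsBoundedOnSchatten.map_conj_of_rankOne (hT : IsBoundedOnSchatten p C T) (hp : 1 ≤ p)
    {V W : H →L[ℂ] H} (hV : ‖V‖ ≤ 1) (hW : ‖W‖ ≤ 1)
    (h : ∀ ξ η, T (V ∘L rankOne ℂ ξ η ∘L W) = V ∘L T (rankOne ℂ ξ η) ∘L W)
    {A : H →L[ℂ] H} (hA : MemSchatten p A) : T (V ∘L A ∘L W) = V ∘L T A ∘L W := by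
  rw [← sub_eq_zero, ← norm_eq_zero]
  refine le_antisymm (le_of_forall_pos_le_add fun ε hε => ?_) (norm_nonneg _)
  let δ := ε / (2 * (C + 1))
  have hδ0 : 0 < δ := by positivity
  obtain ⟨B, hB, hAB⟩ := hA.exists_finiteRank hp hδ0
  have hBm := memSchatten_of_mem_finiteRank hp hB
  have hDm := hA.sub hp hBm
  have hdiff : T (V ∘L A ∘L W) - V ∘L T A ∘L W =
      T (V ∘L (A - B) ∘L W) - V ∘L T (A - B) ∘L W := by
    rw [ContinuousLinearMap.sub_comp, ContinuousLinearMap.comp_sub,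
      hT.map_sub hp (hA.conj hp V W) (hBm.conj hp V W), hT.map_conj_of_mem_finiteRank hp h hB,
      hT.map_sub hp hA hBm, ContinuousLinearMap.sub_comp, ContinuousLinearMap.comp_sub,
      sub_sub_sub_cancel_right]
  have hleft : ‖T (V ∘L (A - B) ∘L W)‖ ≤ C * δ := by
    refine (hT.norm_map_le hp (hDm.conj hp V W)).trans ?_
    gcongr
    refine (schattenReal_conj_le_of_le hp hDm hV hW).trans ?_
    simpa only [one_mul, mul_one] using hAB
  have hright : ‖V ∘L T (A - B) ∘L W‖ ≤ C * δ := by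
    refine (norm_comp_comp_le_of_le hV hW _).trans ((hT.norm_map_le hp hDm).trans ?_)
    gcongr
  have hδ : (C : ℝ) * δ + C * δ ≤ ε := by
    rw [← two_mul, ← mul_assoc, mul_div_assoc', div_le_iff₀ (by positivity)]
    nlinarith
  rw [hdiff, zero_add]
  exact (norm_sub_le _ _).trans ((add_le_add hleft hright).trans hδ)

end Bounded

section Blocks

variable {H : Type*} [NormedAddCommGroup H] [InnerProductSpace ℂ H] [CompleteSpace H]
  {L : Type*} [NormedAddCommGroup L] [InnerProductSpace ℂ L] [CompleteSpace L]
  {p : ℝ≥0∞} {C : ℝ≥0} {T : (H →L[ℂ] H) → (H →L[ℂ] H)} {I : Type*}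

lemma norm_le_one_of_adjoint_apply_self {A : H →L[ℂ] L} (h : ∀ x, adjoint A (A x) = x) :
    ‖A‖ ≤ 1 := by
  have hA : ∀ x, ‖A x‖ = ‖x‖ :=
    (ContinuousLinearMap.norm_map_iff_adjoint_comp_self A).mpr (ContinuousLinearMap.ext h)
  exact ContinuousLinearMap.opNorm_le_bound _ zero_le_one fun x => by rw [hA, one_mul]

/-- The `ι i` are isometries with pairwise orthogonal ranges, so that their ranges are orthogonal
copies of `H` inside `L`. -/
structure OrthogonalCopies (ι : I → H →L[ℂ] L) : Prop where
  adjoint_apply_self : ∀ i x, adjoint (ι i) (ι i x) = x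
  adjoint_apply_of_ne : ∀ i j, i ≠ j → ∀ x, adjoint (ι i) (ι j x) = 0

/-- The projection of `L` onto the sum of the copies of `H` indexed by `F`. -/
def copiesProj (ι : I → H →L[ℂ] L) (F : Finset I) : L →L[ℂ] L :=
  ∑ i ∈ F, ι i ∘L adjoint (ι i)

/-- The map `T` applied to each block of the matrix of an operator on `L` with respect to the
copies of `H` indexed by `F`; the remaining blocks are replaced by zero. -/
def blockMap (T : (H →L[ℂ] H) → (H →L[ℂ] H)) (ι : I → H →L[ℂ] L) (F : Finset I)
    (Z : L →L[ℂ] L) : L →L[ℂ] L :=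
  ∑ i ∈ F, ∑ j ∈ F, ι i ∘L T (adjoint (ι i) ∘L Z ∘L ι j) ∘L adjoint (ι j)

variable {ι : I → H →L[ℂ] L}

lemma copiesProj_apply (F : Finset I) (x : L) :
    copiesProj ι F x = ∑ i ∈ F, ι i (adjoint (ι i) x) := by
  simp only [copiesProj, sum_apply, ContinuousLinearMap.comp_apply]

lemma isSelfAdjoint_copiesProj (F : Finset I) : IsSelfAdjoint (copiesProj ι F) :=
  isSelfAdjoint_sum F fun i _ => by
    rw [ContinuousLinearMap.isSelfAdjoint_iff', ContinuousLinearMap.adjoint_comp,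
      ContinuousLinearMap.adjoint_adjoint]

namespace OrthogonalCopies

lemma adjoint_copiesProj_of_mem (hι : OrthogonalCopies ι) {F : Finset I} {i : I} (hi : i ∈ F)
    (x : L) : adjoint (ι i) (copiesProj ι F x) = adjoint (ι i) x := by
  rw [copiesProj_apply, map_sum, Finset.sum_eq_single_of_mem i hi
    fun j _ hj => hι.adjoint_apply_of_ne i j hj.symm _, hι.adjoint_apply_self]

lemma adjoint_copiesProj_of_notMem (hι : OrthogonalCopies ι) {F : Finset I} {i : I} (hi : i ∉ F)
    (x : L) : adjoint (ι i) (copiesProj ι F x) = 0 := by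
  rw [copiesProj_apply, map_sum]
  exact Finset.sum_eq_zero fun j hj => hι.adjoint_apply_of_ne i j (fun h => hi (h ▸ hj)) _

lemma copiesProj_apply_of_mem (hι : OrthogonalCopies ι) {F : Finset I} {i : I} (hi : i ∈ F)
    (x : H) : copiesProj ι F (ι i x) = ι i x := by
  rw [copiesProj_apply, Finset.sum_eq_single_of_mem i hi
    fun j _ hj => by rw [hι.adjoint_apply_of_ne j i hj, map_zero], hι.adjoint_apply_self]

lemma copiesProj_apply_of_notMem (hι : OrthogonalCopies ι) {F : Finset I} {i : I} (hi : i ∉ F)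
    (x : H) : copiesProj ι F (ι i x) = 0 := by
  rw [copiesProj_apply]
  exact Finset.sum_eq_zero fun j hj => by
    rw [hι.adjoint_apply_of_ne j i fun h => hi (h ▸ hj), map_zero]

lemma isStarProjection_copiesProj (hι : OrthogonalCopies ι) (F : Finset I) :
    IsStarProjection (copiesProj ι F) where
  isSelfAdjoint := isSelfAdjoint_copiesProj F
  isIdempotentElem := ContinuousLinearMap.ext fun x => by
    rw [mul_apply_eq_comp, copiesProj_apply F (copiesProj ι F x), copiesProj_apply F x]
    exact Finset.sum_congr rfl fun i hi => by
      rw [← copiesProj_apply F x, hι.adjoint_copiesProj_of_mem hi]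

lemma block_compress_of_mem (hι : OrthogonalCopies ι) {F : Finset I} {i j : I} (hi : i ∈ F)
    (hj : j ∈ F) (Z : L →L[ℂ] L) :
    adjoint (ι i) ∘L (copiesProj ι F ∘L Z ∘L copiesProj ι F) ∘L ι j =
      adjoint (ι i) ∘L Z ∘L ι j := by
  ext x
  simp only [ContinuousLinearMap.comp_apply, hι.copiesProj_apply_of_mem hj,
    hι.adjoint_copiesProj_of_mem hi]

lemma block_compress_of_notMem (hι : OrthogonalCopies ι) {F : Finset I} {i j : I}
    (h : i ∉ F ∨ j ∉ F) (Z : L →L[ℂ] L) :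
    adjoint (ι i) ∘L (copiesProj ι F ∘L Z ∘L copiesProj ι F) ∘L ι j = 0 := by
  ext x
  rcases h with hi | hj
  · exact hι.adjoint_copiesProj_of_notMem hi _
  · simp only [ContinuousLinearMap.comp_apply, hι.copiesProj_apply_of_notMem hj, map_zero,
      zero_apply]

lemma blockMap_compress (hι : OrthogonalCopies ι) (hT0 : T 0 = 0) {F G : Finset I}
    (hFG : F ⊆ G) (Z : L →L[ℂ] L) :
    blockMap T ι G (copiesProj ι F ∘L Z ∘L copiesProj ι F) = blockMap T ι F Z := by
  have hzero : ∀ i j, i ∉ F ∨ j ∉ F →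
      ι i ∘L T (adjoint (ι i) ∘L (copiesProj ι F ∘L Z ∘L copiesProj ι F) ∘L ι j) ∘L
        adjoint (ι j) = 0 := fun i j h => by
    rw [hι.block_compress_of_notMem h, hT0, ContinuousLinearMap.zero_comp,
      ContinuousLinearMap.comp_zero]
  unfold blockMap
  rw [← Finset.sum_subset hFG fun i _ hi => Finset.sum_eq_zero fun j _ => hzero i j (.inl hi)]
  refine Finset.sum_congr rfl fun i hi => ?_
  rw [← Finset.sum_subset hFG fun j _ hj => hzero i j (.inr hj)]
  exact Finset.sum_congr rfl fun j hj => by rw [hι.block_compress_of_mem hi hj]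

lemma copiesProj_blockMap (hι : OrthogonalCopies ι) (F : Finset I) (Z : L →L[ℂ] L) :
    copiesProj ι F ∘L blockMap T ι F Z ∘L copiesProj ι F = blockMap T ι F Z := by
  ext x
  simp only [blockMap, ContinuousLinearMap.comp_apply, sum_apply, map_sum]
  refine Finset.sum_congr rfl fun i hi => Finset.sum_congr rfl fun j hj => ?_
  rw [hι.adjoint_copiesProj_of_mem hj, hι.copiesProj_apply_of_mem hi]

end OrthogonalCopies

lemma memSchatten_blockMap (hT : IsBoundedOnSchatten p C T) (hp : 1 ≤ p) (F : Finset I)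
    {Z : L →L[ℂ] L} (hZ : MemSchatten p Z) : MemSchatten p (blockMap T ι F Z) :=
  MemSchatten.sum hp _ fun _ _ => MemSchatten.sum hp _ fun _ _ =>
    (hT.mapsTo _ (hZ.conj hp _ _)).conj hp _ _

lemma blockMap_add (hT : IsBoundedOnSchatten p C T) (hp : 1 ≤ p) (F : Finset I)
    {Z W : L →L[ℂ] L} (hZ : MemSchatten p Z) (hW : MemSchatten p W) :
    blockMap T ι F (Z + W) = blockMap T ι F Z + blockMap T ι F W := by
  simp only [blockMap, ← Finset.sum_add_distrib]
  refine Finset.sum_congr rfl fun i _ => Finset.sum_congr rfl fun j _ => ?_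
  rw [ContinuousLinearMap.add_comp, ContinuousLinearMap.comp_add,
    hT.map_add _ _ (hZ.conj hp _ _) (hW.conj hp _ _),
    ContinuousLinearMap.add_comp, ContinuousLinearMap.comp_add]

lemma blockMap_smul (hT : IsBoundedOnSchatten p C T) (hp : 1 ≤ p) (F : Finset I) (c : ℂ)
    {Z : L →L[ℂ] L} (hZ : MemSchatten p Z) :
    blockMap T ι F (c • Z) = c • blockMap T ι F Z := by
  simp only [blockMap, Finset.smul_sum]
  refine Finset.sum_congr rfl fun i _ => Finset.sum_congr rfl fun j _ => ?_
  rw [ContinuousLinearMap.smul_comp, ContinuousLinearMap.comp_smul,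
    hT.map_smul _ _ (hZ.conj hp _ _),
    ContinuousLinearMap.smul_comp, ContinuousLinearMap.comp_smul]

end Blocks

section Signs

variable {H : Type*} [NormedAddCommGroup H] [InnerProductSpace ℂ H] [CompleteSpace H]
  {L : Type*} [NormedAddCommGroup L] [InnerProductSpace ℂ L] [CompleteSpace L]
  {p : ℝ≥0∞} {C : ℝ≥0} {T : (H →L[ℂ] H) → (H →L[ℂ] H)} {I : Type*} {ι : I → H →L[ℂ] L}
  {R : I → H →L[ℂ] H}

/-- The `R i` are self-adjoint unitaries, and `T` commutes with multiplication by them from the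
left and from the right. -/
structure IsSignFamily (p : ℝ≥0∞) (T : (H →L[ℂ] H) → (H →L[ℂ] H)) (R : I → H →L[ℂ] H) :
    Prop where
  isSelfAdjoint : ∀ i, IsSelfAdjoint (R i)
  apply_apply : ∀ i x, R i (R i x) = x
  map_conj : ∀ i j A, MemSchatten p A → T (R i ∘L A ∘L R j) = R i ∘L T A ∘L R j

lemma IsSignFamily.comp {J : Type*} (hR : IsSignFamily p T R) (e : J → I) :
    IsSignFamily p T (R ∘ e) where
  isSelfAdjoint j := hR.isSelfAdjoint (e j)
  apply_apply j := hR.apply_apply (e j)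
  map_conj i j := hR.map_conj (e i) (e j)

lemma IsSignFamily.norm_le_one (hR : IsSignFamily p T R) (i : I) : ‖R i‖ ≤ 1 :=
  norm_le_one_of_adjoint_apply_self fun x => by
    rw [(hR.isSelfAdjoint i).adjoint_eq, hR.apply_apply]

/-- There are infinite sign families for `T` whose members are as close to being orthogonal to
each other as desired when tested on finitely many vectors. This is what remains of Schur
multipliers over atomless measure spaces in the amplification argument. -/
def CommutesWithSigns (p : ℝ≥0∞) (T : (H →L[ℂ] H) → (H →L[ℂ] H)) : Prop :=
  ∀ (S : Finset H) (ε : ℝ), 0 < ε → ∃ R : ℕ → H →L[ℂ] H, IsSignFamily p T R ∧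
    Pairwise fun m n => ∀ f ∈ S, ∀ g ∈ S, ‖inner ℂ (R m f) (R n g)‖ < ε

lemma CommutesWithSigns.exists_isSignFamily (hS : CommutesWithSigns p T) (F : Finset I)
    (S : Finset H) {ε : ℝ} (hε : 0 < ε) : ∃ R : I → H →L[ℂ] H, IsSignFamily p T R ∧
      (F : Set I).Pairwise fun i j => ∀ f ∈ S, ∀ g ∈ S, ‖inner ℂ (R i f) (R j g)‖ < ε := by
  obtain ⟨R, hR, hRS⟩ := hS S ε hε
  obtain ⟨e, he⟩ := Set.countable_iff_exists_injOn.mp F.countable_toSet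
  exact ⟨R ∘ e, hR.comp e, fun i hi j hj hij => hRS fun h => hij (he hi hj h)⟩

/-- The operator `∑ R i ∘ (ι i)⋆` from `L` to `H`. When the `R i` are signs nearly orthogonal to
each other, it is nearly isometric on the given copies of `H`. -/
def signedSum (ι : I → H →L[ℂ] L) (R : I → H →L[ℂ] H) (F : Finset I) : L →L[ℂ] H :=
  ∑ i ∈ F, R i ∘L adjoint (ι i)

lemma signedSum_apply (F : Finset I) (x : L) :
    signedSum ι R F x = ∑ i ∈ F, R i (adjoint (ι i) x) := by
  simp only [signedSum, sum_apply, ContinuousLinearMap.comp_apply]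

lemma adjoint_signedSum_apply (hR : ∀ i, IsSelfAdjoint (R i)) (F : Finset I) (x : H) :
    adjoint (signedSum ι R F) x = ∑ i ∈ F, ι i (R i x) := by
  simp only [signedSum, map_sum, ContinuousLinearMap.adjoint_comp,
    ContinuousLinearMap.adjoint_adjoint, (hR _).adjoint_eq, sum_apply,
    ContinuousLinearMap.comp_apply]

lemma OrthogonalCopies.norm_signedSum_le (hι : OrthogonalCopies ι) (hR : ∀ i, ‖R i‖ ≤ 1)
    (F : Finset I) : ‖signedSum ι R F‖ ≤ F.card := by
  refine (norm_sum_le_of_le (n := fun _ => (1 : ℝ)) F fun i _ => ?_).trans_eq (by simp)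
  refine (ContinuousLinearMap.opNorm_comp_le _ _).trans ?_
  rw [LinearIsometryEquiv.norm_map]
  exact mul_le_one₀ (hR i) (norm_nonneg _)
    (norm_le_one_of_adjoint_apply_self (hι.adjoint_apply_self i))

lemma OrthogonalCopies.signedSum_apply_of_mem (hι : OrthogonalCopies ι) {F : Finset I} {i : I}
    (hi : i ∈ F) (x : H) : signedSum ι R F (ι i x) = R i x := by
  rw [signedSum_apply, Finset.sum_eq_single_of_mem i hi
    fun j _ hj => by rw [hι.adjoint_apply_of_ne j i hj, map_zero], hι.adjoint_apply_self]

lemma OrthogonalCopies.adjoint_adjoint_signedSum_apply (hι : OrthogonalCopies ι)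
    (hR : ∀ i, IsSelfAdjoint (R i)) {F : Finset I} {i : I} (hi : i ∈ F) (x : H) :
    adjoint (ι i) (adjoint (signedSum ι R F) x) = R i x := by
  rw [adjoint_signedSum_apply hR, map_sum, Finset.sum_eq_single_of_mem i hi
    fun j _ hj => hι.adjoint_apply_of_ne i j hj.symm _, hι.adjoint_apply_self]

lemma signedSum_conj (hR : ∀ i, IsSelfAdjoint (R i)) (F : Finset I) (Z : L →L[ℂ] L) :
    signedSum ι R F ∘L Z ∘L adjoint (signedSum ι R F) =
      ∑ i ∈ F, ∑ j ∈ F, R i ∘L (adjoint (ι i) ∘L Z ∘L ι j) ∘L R j := by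
  ext x
  simp only [ContinuousLinearMap.comp_apply, adjoint_signedSum_apply hR, signedSum_apply,
    sum_apply, map_sum]
  exact Finset.sum_comm

lemma OrthogonalCopies.signedSum_conj_blockMap (hι : OrthogonalCopies ι)
    (hR : ∀ i, IsSelfAdjoint (R i)) (F : Finset I) (Z : L →L[ℂ] L) :
    signedSum ι R F ∘L blockMap T ι F Z ∘L adjoint (signedSum ι R F) =
      ∑ i ∈ F, ∑ j ∈ F, R i ∘L T (adjoint (ι i) ∘L Z ∘L ι j) ∘L R j := by
  ext x
  simp only [blockMap, ContinuousLinearMap.comp_apply, sum_apply, map_sum]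
  refine Finset.sum_congr rfl fun i hi => Finset.sum_congr rfl fun j hj => ?_
  rw [hι.signedSum_apply_of_mem hi, hι.adjoint_adjoint_signedSum_apply hR hj]

lemma OrthogonalCopies.map_signedSum_conj (hι : OrthogonalCopies ι)
    (hT : IsBoundedOnSchatten p C T) (hp : 1 ≤ p) (hR : IsSignFamily p T R) (F : Finset I)
    {Z : L →L[ℂ] L} (hZ : MemSchatten p Z) :
    T (signedSum ι R F ∘L Z ∘L adjoint (signedSum ι R F)) =
      signedSum ι R F ∘L blockMap T ι F Z ∘L adjoint (signedSum ι R F) := by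
  have hblock : ∀ i j, MemSchatten p (adjoint (ι i) ∘L Z ∘L ι j) := fun i j => hZ.conj hp _ _
  have hconj : ∀ i j, MemSchatten p (R i ∘L (adjoint (ι i) ∘L Z ∘L ι j) ∘L R j) := fun i j =>
    (hblock i j).conj hp _ _
  rw [signedSum_conj hR.isSelfAdjoint, hι.signedSum_conj_blockMap hR.isSelfAdjoint,
    hT.map_sum hp _ fun i => MemSchatten.sum hp _ fun j _ => hconj i j]
  simp_rw [hT.map_sum hp F fun j => hconj _ j, hR.map_conj _ _ _ (hblock _ _)]

lemma IsSignFamily.norm_inner_signedSum_sub_le (hR : IsSignFamily p T R) {F : Finset I}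
    {S : Finset H} {ε : ℝ} (hε : 0 ≤ ε)
    (h : (F : Set I).Pairwise fun i j => ∀ f ∈ S, ∀ g ∈ S, ‖inner ℂ (R i f) (R j g)‖ < ε)
    {x y : L} (hx : ∀ i ∈ F, adjoint (ι i) x ∈ S) (hy : ∀ i ∈ F, adjoint (ι i) y ∈ S) :
    ‖inner ℂ (signedSum ι R F x) (signedSum ι R F y) - inner ℂ x (copiesProj ι F y)‖ ≤
      F.card ^ 2 * ε := by
  classical
  have hdiag : ∀ i, inner ℂ (R i (adjoint (ι i) x)) (R i (adjoint (ι i) y)) =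
      inner ℂ x (ι i (adjoint (ι i) y)) := fun i => by
    rw [← ContinuousLinearMap.adjoint_inner_right, (hR.isSelfAdjoint i).adjoint_eq,
      hR.apply_apply, ContinuousLinearMap.adjoint_inner_left]
  have hoff : inner ℂ (signedSum ι R F x) (signedSum ι R F y) - inner ℂ x (copiesProj ι F y) =
      ∑ i ∈ F, ∑ j ∈ F.erase i, inner ℂ (R i (adjoint (ι i) x)) (R j (adjoint (ι j) y)) := by
    rw [signedSum_apply, signedSum_apply, copiesProj_apply, sum_inner, inner_sum,
      ← Finset.sum_sub_distrib]
    refine Finset.sum_congr rfl fun i hi => ?_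
    rw [inner_sum, ← Finset.add_sum_erase F _ hi, hdiag, add_sub_cancel_left]
  have hrow : ∀ i ∈ F,
      ‖∑ j ∈ F.erase i, inner ℂ (R i (adjoint (ι i) x)) (R j (adjoint (ι j) y))‖ ≤
        F.card * ε := fun i hi => by
    refine (norm_sum_le_of_le _ fun j hj => (h hi (Finset.mem_of_mem_erase hj)
      (Finset.ne_of_mem_erase hj).symm _ (hx i hi) _ (hy j (Finset.mem_of_mem_erase hj))).le).trans
        ?_
    rw [Finset.sum_const, nsmul_eq_mul]
    gcongr
    exact Finset.erase_subset i F
  calc _ ≤ ∑ _i ∈ F, F.card * ε := hoff ▸ norm_sum_le_of_le F hrow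
    _ = F.card ^ 2 * ε := by rw [Finset.sum_const, nsmul_eq_mul, pow_two, mul_assoc]

omit [CompleteSpace L] in
lemma norm_starProjection_conj_le {E : Submodule ℂ L} [FiniteDimensional ℂ E] {κ : Type*}
    [Fintype κ] (u : OrthonormalBasis κ ℂ E) (A : L →L[ℂ] L) {c : ℝ}
    (h : ∀ a b, ‖inner ℂ (u a : L) (A (u b))‖ ≤ c) :
    ‖E.starProjection ∘L A ∘L E.starProjection‖ ≤ Fintype.card κ ^ 2 * c := by
  have hproj : ∀ x, E.starProjection x = ∑ a, inner ℂ (u a : L) x • (u a : L) := fun x => by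
    rw [u.starProjection_eq_sum_rankOne]
    simp only [sum_apply, rankOne_apply]
  have hsum : E.starProjection ∘L A ∘L E.starProjection =
      ∑ a, ∑ b, inner ℂ (u a : L) (A (u b)) • rankOne ℂ (u a : L) (u b : L) := by
    ext x
    rw [ContinuousLinearMap.comp_apply, ContinuousLinearMap.comp_apply, hproj, hproj x, sum_apply]
    refine Finset.sum_congr rfl fun a _ => ?_
    rw [sum_apply, map_sum, inner_sum, Finset.sum_smul]
    refine Finset.sum_congr rfl fun b _ => ?_
    rw [map_smul, inner_smul_right, smul_apply, rankOne_apply, smul_smul, mul_comm]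
  have hterm : ∀ a b, ‖inner ℂ (u a : L) (A (u b)) • rankOne ℂ (u a : L) (u b : L)‖ ≤ c :=
    fun a b => by
      have hu : ∀ a, ‖(u a : L)‖ = 1 := u.orthonormal.1
      rw [norm_smul, norm_rankOne, hu, hu, mul_one, mul_one]
      exact h a b
  rw [hsum]
  calc _ ≤ ∑ _a : κ, ∑ _b : κ, c :=
        norm_sum_le_of_le _ fun a _ => norm_sum_le_of_le _ fun b _ => hterm a b
    _ = Fintype.card κ ^ 2 * c := by
        rw [Finset.sum_const, Finset.sum_const, Finset.card_univ, smul_smul, nsmul_eq_mul,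
          Nat.cast_mul, pow_two]

lemma CommutesWithSigns.exists_nearly_isometric (hS : CommutesWithSigns p T) (F : Finset I)
    (E : Submodule ℂ L) [FiniteDimensional ℂ E] (hE : ∀ x ∈ E, copiesProj ι F x = x) {δ : ℝ}
    (hδ : 0 < δ) : ∃ R : I → H →L[ℂ] H, IsSignFamily p T R ∧
      ‖E.starProjection ∘L (adjoint (signedSum ι R F) ∘L signedSum ι R F) ∘L E.starProjection -
        E.starProjection‖ ≤ δ := by
  classical
  let u := stdOrthonormalBasis ℂ E
  let n := Module.finrank ℂ E
  let S : Finset H := (Finset.univ ×ˢ F).image fun ai => adjoint (ι ai.2) (u ai.1 : L)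
  have hmem : ∀ a, ∀ i ∈ F, adjoint (ι i) (u a : L) ∈ S := fun a i hi =>
    Finset.mem_image.mpr ⟨(a, i), Finset.mk_mem_product (Finset.mem_univ a) hi, rfl⟩
  let ε := δ / ((n : ℝ) ^ 2 * (F.card : ℝ) ^ 2 + 1)
  have hε : 0 < ε := by positivity
  obtain ⟨R, hR, hRS⟩ := hS.exists_isSignFamily F S hε
  refine ⟨R, hR, ?_⟩
  let V := signedSum ι R F
  let P := E.starProjection
  have hsub : P ∘L (adjoint V ∘L V) ∘L P - P = P ∘L (adjoint V ∘L V - 1) ∘L P := by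
    have hPP : P ∘L P = P := E.isIdempotentElem_starProjection
    rw [ContinuousLinearMap.sub_comp, ContinuousLinearMap.comp_sub,
      ContinuousLinearMap.one_def, ContinuousLinearMap.id_comp, hPP]
  have hentry : ∀ a b, ‖inner ℂ (u a : L) ((adjoint V ∘L V - 1) (u b : L))‖ ≤ F.card ^ 2 * ε := by
    intro a b
    have := hR.norm_inner_signedSum_sub_le hε.le hRS (hmem a) (hmem b)
    rwa [hE _ (u b).2, ← ContinuousLinearMap.adjoint_inner_right, ← inner_sub_right] at this
  rw [hsub]
  calc _ ≤ (n : ℝ) ^ 2 * ((F.card : ℝ) ^ 2 * ε) := by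
        simpa only [Fintype.card_fin] using norm_starProjection_conj_le u _ hentry
    _ ≤ δ := by
        rw [← mul_assoc, mul_div_assoc', div_le_iff₀ (by positivity)]
        nlinarith

end Signs

section FiniteBlocks

variable {H : Type*} [NormedAddCommGroup H] [InnerProductSpace ℂ H] [CompleteSpace H]
  {L : Type*} [NormedAddCommGroup L] [InnerProductSpace ℂ L] [CompleteSpace L]
  {p : ℝ≥0∞} {C : ℝ≥0} {T : (H →L[ℂ] H) → (H →L[ℂ] H)} {I : Type*} {ι : I → H →L[ℂ] L}

omit [CompleteSpace L] in
lemma apply_eq_self_of_mem_span_image {Q : L →L[ℂ] L} (hQ : ∀ x, Q (Q x) = Q x) {s : Set L}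
    {x : L} (hx : x ∈ Submodule.span ℂ (Q '' s)) : Q x = x := by
  induction hx using Submodule.span_induction with
  | mem x hx => obtain ⟨y, -, rfl⟩ := hx; exact hQ y
  | zero => rw [map_zero]
  | add x y _ _ hx hy => rw [map_add, hx, hy]
  | smul c x _ hx => rw [map_smul, hx]

omit [CompleteSpace L] in
instance finiteDimensional_span_image (Q : L →L[ℂ] L) (s : Finset L) :
    FiniteDimensional ℂ (Submodule.span ℂ (Q '' (s : Set L))) :=
  FiniteDimensional.span_of_finite ℂ (s.finite_toSet.image _)

lemma starProjection_span_image_apply {Q : L →L[ℂ] L} (hQ : IsStarProjection Q) {s : Set L}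
    [(Submodule.span ℂ (Q '' s)).HasOrthogonalProjection] {x : L} (hx : x ∈ s) :
    (Submodule.span ℂ (Q '' s)).starProjection x = Q x := by
  have hQQ : ∀ x, Q (Q x) = Q x := fun x => congrArg (· x) hQ.isIdempotentElem
  refine Submodule.eq_starProjection_of_mem_of_inner_eq_zero
    (Submodule.subset_span (Set.mem_image_of_mem Q hx)) fun y hy => ?_
  rw [inner_sub_left, ← apply_eq_self_of_mem_span_image hQQ hy,
    ← ContinuousLinearMap.adjoint_inner_left, ← ContinuousLinearMap.adjoint_inner_left,
    hQ.isSelfAdjoint.adjoint_eq, hQQ, sub_self]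

lemma tendsto_starProjection_span_image {Q : L →L[ℂ] L} (hQ : IsStarProjection Q) (x : L) :
    Tendsto (fun s : Finset L => (Submodule.span ℂ (Q '' (s : Set L))).starProjection x) atTop
      (𝓝 (Q x)) := by
  refine tendsto_const_nhds.congr' ?_
  filter_upwards [eventually_ge_atTop {x}] with s hs
  exact (starProjection_span_image_apply hQ
    (Finset.mem_coe.mpr (hs (Finset.mem_singleton_self x)))).symm

lemma exists_finiteDimensional_compression (hp : 1 ≤ p) {Q : L →L[ℂ] L} (hQ : IsStarProjection Q)
    {Z Y : L →L[ℂ] L} (hZ : MemSchatten p Z) (hY : MemSchatten p Y) (hZQ : Q ∘L Z ∘L Q = Z)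
    (hYQ : Q ∘L Y ∘L Q = Y) {ε : ℝ} (hε : 0 < ε) :
    ∃ E : Submodule ℂ L, ∃ _ : FiniteDimensional ℂ E, (∀ x ∈ E, Q x = x) ∧
      schattenReal p (E.starProjection ∘L Z ∘L E.starProjection - Z) < ε ∧
      schattenReal p (E.starProjection ∘L Y ∘L E.starProjection - Y) < ε := by
  let E : Finset L → Submodule ℂ L := fun s => Submodule.span ℂ (Q '' s)
  have hfin : ∀ s, FiniteDimensional ℂ (E s) := finiteDimensional_span_image Q
  have hlim : ∀ x, Tendsto (fun s => (E s).starProjection x) atTop (𝓝 (Q x)) :=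
    tendsto_starProjection_span_image hQ
  have hnorm : ∀ s, ‖(E s).starProjection‖ ≤ 1 := fun s => (E s).starProjection_norm_le
  have hclose : ∀ {W : L →L[ℂ] L}, MemSchatten p W → Q ∘L W ∘L Q = W → ∀ᶠ s in atTop,
      schattenReal p ((E s).starProjection ∘L W ∘L (E s).starProjection - W) < ε := by
    intro W hW hWQ
    have := hW.tendsto_schattenReal_conj_sub hp hlim hlim hnorm hnorm hQ.norm_le hQ.norm_le
    simp only [(isSelfAdjoint_starProjection (E _)).adjoint_eq, hQ.isSelfAdjoint.adjoint_eq,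
      hWQ] at this
    exact this.eventually_lt_const hε
  obtain ⟨s, hZs, hYs⟩ := ((hclose hZ hZQ).and (hclose hY hYQ)).exists
  exact ⟨E s, hfin s,
    fun x => apply_eq_self_of_mem_span_image fun x => congrArg (· x) hQ.isIdempotentElem, hZs, hYs⟩

lemma norm_comp_projection_le {V : L →L[ℂ] H} {P : L →L[ℂ] L} (hP : IsStarProjection P) {δ : ℝ}
    (hV : ‖P ∘L (adjoint V ∘L V) ∘L P - P‖ ≤ δ) : ‖V ∘L P‖ ≤ 1 + δ := by
  have hδ : 0 ≤ δ := (norm_nonneg _).trans hV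
  have hsq : ‖V ∘L P‖ * ‖V ∘L P‖ ≤ 1 + δ := by
    rw [← ContinuousLinearMap.norm_adjoint_comp_self, ContinuousLinearMap.adjoint_comp,
      hP.isSelfAdjoint.adjoint_eq]
    calc ‖(P ∘L adjoint V) ∘L (V ∘L P)‖ = ‖P + (P ∘L (adjoint V ∘L V) ∘L P - P)‖ := by
          rw [add_sub_cancel]; rfl
      _ ≤ 1 + δ := norm_add_le_of_le hP.norm_le hV
  nlinarith [norm_nonneg (V ∘L P)]

lemma comp_projection_conj {V : L →L[ℂ] H} {P : L →L[ℂ] L} (hP : IsSelfAdjoint P)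
    (Y : L →L[ℂ] L) :
    V ∘L (P ∘L Y ∘L P) ∘L adjoint V = (V ∘L P) ∘L Y ∘L adjoint (V ∘L P) := by
  rw [ContinuousLinearMap.adjoint_comp, hP.adjoint_eq]
  rfl

lemma schattenReal_compress_le (hp : 1 ≤ p) {V : L →L[ℂ] H} {P : L →L[ℂ] L}
    (hP : IsStarProjection P) {δ : ℝ} (hV : ‖P ∘L (adjoint V ∘L V) ∘L P - P‖ ≤ δ)
    {Y : L →L[ℂ] L} (hY : MemSchatten p Y) :
    schattenReal p (P ∘L Y ∘L P) ≤ (1 + δ) ^ 2 *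
      schattenReal p (V ∘L (P ∘L Y ∘L P) ∘L adjoint V) + (2 * δ + δ ^ 2) * schattenReal p Y := by
  let G := P ∘L (adjoint V ∘L V) ∘L P
  have hVP := norm_comp_projection_le hP hV
  have hG : ‖G‖ ≤ 1 + δ := by
    rw [← add_sub_cancel P G]
    exact norm_add_le_of_le hP.norm_le hV
  have hPG : ‖P - G‖ ≤ δ := by rwa [norm_sub_rev]
  have hsplit : P ∘L Y ∘L P = G ∘L Y ∘L G + ((P - G) ∘L Y ∘L P + G ∘L Y ∘L (P - G)) := by
    simp only [ContinuousLinearMap.sub_comp, ContinuousLinearMap.comp_sub]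
    abel
  have hmain : schattenReal p (G ∘L Y ∘L G) ≤
      (1 + δ) * schattenReal p (V ∘L (P ∘L Y ∘L P) ∘L adjoint V) * (1 + δ) := by
    have hGYG : G ∘L Y ∘L G =
        adjoint (V ∘L P) ∘L (V ∘L (P ∘L Y ∘L P) ∘L adjoint V) ∘L (V ∘L P) := by
      rw [ContinuousLinearMap.adjoint_comp, hP.isSelfAdjoint.adjoint_eq]
      rfl
    rw [hGYG]
    exact schattenReal_conj_le_of_le hp ((hY.conj hp P P).conj hp V (adjoint V))
      (by rwa [LinearIsometryEquiv.norm_map]) hVP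
  have hleft := schattenReal_conj_le_of_le hp hY hPG hP.norm_le
  have hright := schattenReal_conj_le_of_le hp hY hG hPG
  have hadd := schattenReal_add_le hp (hY.conj hp G G)
    ((hY.conj hp (P - G) P).add hp (hY.conj hp G (P - G)))
  have hadd' := schattenReal_add_le hp (hY.conj hp (P - G) P) (hY.conj hp G (P - G))
  rw [← hsplit] at hadd
  linarith

lemma schattenReal_conj_le_add (hp : 1 ≤ p) {V : L →L[ℂ] H} {m : ℝ} (hV : ‖V‖ ≤ m)
    {Y W : L →L[ℂ] L} (hY : MemSchatten p Y) (hW : MemSchatten p W) {ε : ℝ}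
    (h : schattenReal p (Y - W) ≤ ε) :
    schattenReal p (V ∘L Y ∘L adjoint V) ≤
      schattenReal p (V ∘L W ∘L adjoint V) + m ^ 2 * ε := by
  have hsplit : V ∘L Y ∘L adjoint V = V ∘L W ∘L adjoint V + V ∘L (Y - W) ∘L adjoint V := by
    rw [ContinuousLinearMap.sub_comp, ContinuousLinearMap.comp_sub, add_sub_cancel]
  have hdiff := schattenReal_conj_le_of_le hp (hY.sub hp hW) hV
    ((LinearIsometryEquiv.norm_map adjoint V).trans_le hV)
  rw [hsplit]
  refine (schattenReal_add_le hp (hW.conj hp _ _) ((hY.sub hp hW).conj hp _ _)).trans ?_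
  nlinarith [mul_le_mul_of_nonneg_left h (sq_nonneg m)]

lemma schattenReal_sub_comm (A B : H →L[ℂ] H) :
    schattenReal p (A - B) = schattenReal p (B - A) := by
  rw [← neg_sub B A, schattenReal, schattenReal, schattenNorm, schattenNorm, CFC.abs_neg, enorm_neg]

lemma schattenReal_le_of_nearly_isometric (hp : 1 ≤ p) {V : L →L[ℂ] H} {P : L →L[ℂ] L}
    (hP : IsStarProjection P) {m ε : ℝ} (hVm : ‖V‖ ≤ m)
    (hV : ‖P ∘L (adjoint V ∘L V) ∘L P - P‖ ≤ ε) {Z Y : L →L[ℂ] L} (hZ : MemSchatten p Z)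
    (hY : MemSchatten p Y) (hPZ : schattenReal p (P ∘L Z ∘L P - Z) ≤ ε)
    (hPY : schattenReal p (P ∘L Y ∘L P - Y) ≤ ε)
    (hYZ : schattenReal p (V ∘L Y ∘L adjoint V) ≤ C * schattenReal p (V ∘L Z ∘L adjoint V)) :
    schattenReal p Y ≤ ε +
      ((1 + ε) ^ 2 * (C * ((1 + ε) ^ 2 * schattenReal p Z + m ^ 2 * ε) + m ^ 2 * ε) +
        (2 * ε + ε ^ 2) * schattenReal p Y) := by
  have hPYP := hY.conj hp P P
  have hPZP := hZ.conj hp P P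
  have hVZ : schattenReal p (V ∘L Z ∘L adjoint V) ≤
      (1 + ε) ^ 2 * schattenReal p Z + m ^ 2 * ε := by
    have hVPZ : schattenReal p (V ∘L (P ∘L Z ∘L P) ∘L adjoint V) ≤
        (1 + ε) * schattenReal p Z * (1 + ε) := by
      have hVP := norm_comp_projection_le hP hV
      rw [comp_projection_conj hP.isSelfAdjoint]
      exact schattenReal_conj_le_of_le hp hZ hVP
        ((LinearIsometryEquiv.norm_map adjoint _).trans_le hVP)
    have := schattenReal_conj_le_add hp hVm hZ hPZP ((schattenReal_sub_comm _ _).trans_le hPZ)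
    linarith
  have hVY : schattenReal p (V ∘L (P ∘L Y ∘L P) ∘L adjoint V) ≤
      C * ((1 + ε) ^ 2 * schattenReal p Z + m ^ 2 * ε) + m ^ 2 * ε :=
    (schattenReal_conj_le_add hp hVm hPYP hY hPY).trans
      (add_le_add_left (hYZ.trans (mul_le_mul_of_nonneg_left hVZ C.coe_nonneg)) _)
  calc schattenReal p Y = schattenReal p (P ∘L Y ∘L P - (P ∘L Y ∘L P - Y)) := by
        rw [sub_sub_cancel]
    _ ≤ schattenReal p (P ∘L Y ∘L P) + ε :=
        (schattenReal_sub_le hp hPYP (hPYP.sub hp hY)).trans (by gcongr)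
    _ ≤ _ := by
        have := schattenReal_compress_le hp hP hV hY
        have := mul_le_mul_of_nonneg_left hVY (sq_nonneg (1 + ε))
        linarith

lemma OrthogonalCopies.schattenReal_blockMap_le_of_compress (hι : OrthogonalCopies ι)
    (hT : IsBoundedOnSchatten p C T) (hp : 1 ≤ p) (hS : CommutesWithSigns p T) (F : Finset I)
    {Z : L →L[ℂ] L} (hZ : MemSchatten p Z) (hZQ : copiesProj ι F ∘L Z ∘L copiesProj ι F = Z) :
    schattenReal p (blockMap T ι F Z) ≤ C * schattenReal p Z := by
  let Y := blockMap T ι F Z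
  have hY : MemSchatten p Y := memSchatten_blockMap hT hp F hZ
  let y := schattenReal p Y
  let z := schattenReal p Z
  let m : ℝ := F.card
  let bound : ℝ → ℝ := fun ε => ε +
    ((1 + ε) ^ 2 * (C * ((1 + ε) ^ 2 * z + m ^ 2 * ε) + m ^ 2 * ε) + (2 * ε + ε ^ 2) * y)
  have hbound : ∀ ε > 0, y ≤ bound ε := by
    intro ε hε
    obtain ⟨E, _, hEQ, hZE, hYE⟩ := exists_finiteDimensional_compression hp
      (hι.isStarProjection_copiesProj F) hZ hY hZQ (hι.copiesProj_blockMap F Z) hε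
    obtain ⟨R, hR, hV⟩ := hS.exists_nearly_isometric F E hEQ hε
    refine schattenReal_le_of_nearly_isometric hp isStarProjection_starProjection
      (hι.norm_signedSum_le hR.norm_le_one F) hV hZ hY hZE.le hYE.le ?_
    rw [← hι.map_signedSum_conj hT hp hR F hZ]
    exact hT.schattenReal_le hp (hZ.conj hp _ _)
  have hlim : Tendsto bound (𝓝[>] 0) (𝓝 (C * z)) := by
    have hcont : Continuous bound := by fun_prop
    have hzero : bound 0 = C * z := by simp only [bound]; ring
    exact hzero ▸ (hcont.tendsto 0).mono_left nhdsWithin_le_nhds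
  exact ge_of_tendsto hlim (eventually_mem_nhdsWithin.mono hbound)

lemma OrthogonalCopies.schattenReal_blockMap_le (hι : OrthogonalCopies ι)
    (hT : IsBoundedOnSchatten p C T) (hp : 1 ≤ p) (hS : CommutesWithSigns p T) (F : Finset I)
    {Z : L →L[ℂ] L} (hZ : MemSchatten p Z) :
    schattenReal p (blockMap T ι F Z) ≤ C * schattenReal p Z := by
  let Q := copiesProj ι F
  have hQ : IsStarProjection Q := hι.isStarProjection_copiesProj F
  have hQQ : Q ∘L Q = Q := hQ.isIdempotentElem
  have hQZQ : Q ∘L (Q ∘L Z ∘L Q) ∘L Q = Q ∘L Z ∘L Q := by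
    rw [ContinuousLinearMap.comp_assoc, ContinuousLinearMap.comp_assoc, hQQ,
      ← ContinuousLinearMap.comp_assoc, hQQ]
  rw [← hι.blockMap_compress (hT.map_zero hp) subset_rfl]
  refine (hι.schattenReal_blockMap_le_of_compress hT hp hS F (hZ.conj hp Q Q) hQZQ).trans ?_
  gcongr
  simpa only [one_mul, mul_one] using schattenReal_conj_le_of_le hp hZ hQ.norm_le hQ.norm_le

end FiniteBlocks

section InfiniteBlocks

variable {H : Type*} [NormedAddCommGroup H] [InnerProductSpace ℂ H] [CompleteSpace H]
  {L : Type*} [NormedAddCommGroup L] [InnerProductSpace ℂ L] [CompleteSpace L]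
  {p : ℝ≥0∞} {C : ℝ≥0} {T : (H →L[ℂ] H) → (H →L[ℂ] H)} {I : Type*} {ι : I → H →L[ℂ] L}

/-- The operator whose blocks are the images under `T` of the blocks of `Z`, as a strong limit
over the finite sets of copies. The value is `0` if there is no such limit. -/
def amplification (T : (H →L[ℂ] H) → (H →L[ℂ] H)) (ι : I → H →L[ℂ] L) (Z : L →L[ℂ] L) :
    L →L[ℂ] L :=
  open Classical in
  if h : ∃ W : L →L[ℂ] L, ∀ x, Tendsto (fun F => blockMap T ι F Z x) atTop (𝓝 (W x)) then h.choose
  else 0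

lemma amplification_eq {Z W : L →L[ℂ] L}
    (h : ∀ x, Tendsto (fun F => blockMap T ι F Z x) atTop (𝓝 (W x))) :
    amplification T ι Z = W := by
  classical
  have hex : ∃ W : L →L[ℂ] L, ∀ x, Tendsto (fun F => blockMap T ι F Z x) atTop (𝓝 (W x)) := ⟨W, h⟩
  rw [amplification, dif_pos hex]
  exact ContinuousLinearMap.ext fun x => tendsto_nhds_unique (hex.choose_spec x) (h x)

lemma amplification_eq_of_tendsto {Z W : L →L[ℂ] L}
    (h : Tendsto (fun F => blockMap T ι F Z) atTop (𝓝 W)) : amplification T ι Z = W :=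
  amplification_eq fun x => ((ContinuousLinearMap.apply ℂ L x).continuous.tendsto W).comp h

namespace OrthogonalCopies

lemma cauchySeq_blockMap (hι : OrthogonalCopies ι)
    (hlim : ∀ x, Tendsto (fun F => copiesProj ι F x) atTop (𝓝 x))
    (hT : IsBoundedOnSchatten p C T) (hp : 1 ≤ p) (hS : CommutesWithSigns p T)
    {Z : L →L[ℂ] L} (hZ : MemSchatten p Z) : CauchySeq fun F => blockMap T ι F Z := by
  classical
  refine Metric.cauchySeq_iff'.mpr fun ε hε => ?_
  let P := copiesProj ι
  have hP : ∀ F, ‖P F‖ ≤ 1 := fun F => (hι.isStarProjection_copiesProj F).norm_le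
  have hPZP : Tendsto (fun F => C * schattenReal p (P F ∘L Z ∘L P F - Z)) atTop (𝓝 0) := by
    have h := (hZ.tendsto_schattenReal_conj_sub hp (V₀ := ContinuousLinearMap.id ℂ L)
      (W₀ := ContinuousLinearMap.id ℂ L) hlim hlim hP hP ContinuousLinearMap.norm_id_le
      ContinuousLinearMap.norm_id_le).const_mul (C : ℝ)
    simpa only [(isSelfAdjoint_copiesProj _).adjoint_eq, ContinuousLinearMap.adjoint_id,
      ContinuousLinearMap.comp_id, ContinuousLinearMap.id_comp, mul_zero] using h
  obtain ⟨G, hG⟩ := (hPZP.eventually_lt_const hε).exists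
  refine ⟨G, fun F hF => ?_⟩
  have hdiff : MemSchatten p (P G ∘L Z ∘L P G - Z) := (hZ.conj hp _ _).sub hp hZ
  have hsplit : blockMap T ι G Z = blockMap T ι F (P G ∘L Z ∘L P G - Z) + blockMap T ι F Z := by
    rw [← blockMap_add hT hp F hdiff hZ, sub_add_cancel,
      hι.blockMap_compress (hT.map_zero hp) hF]
  rw [dist_comm, dist_eq_norm, hsplit, add_sub_cancel_right]
  exact ((memSchatten_blockMap hT hp F hdiff).norm_le hp).trans_lt
    ((hι.schattenReal_blockMap_le hT hp hS F hdiff).trans_lt hG)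

lemma tendsto_blockMap (hι : OrthogonalCopies ι)
    (hlim : ∀ x, Tendsto (fun F => copiesProj ι F x) atTop (𝓝 x))
    (hT : IsBoundedOnSchatten p C T) (hp : 1 ≤ p) (hS : CommutesWithSigns p T)
    {Z : L →L[ℂ] L} (hZ : MemSchatten p Z) :
    Tendsto (fun F => blockMap T ι F Z) atTop (𝓝 (amplification T ι Z)) := by
  classical
  obtain ⟨W, hW⟩ := cauchySeq_tendsto_of_complete (hι.cauchySeq_blockMap hlim hT hp hS hZ)
  rwa [amplification_eq_of_tendsto hW]

lemma isBoundedOnSchatten_amplification (hι : OrthogonalCopies ι)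
    (hlim : ∀ x, Tendsto (fun F => copiesProj ι F x) atTop (𝓝 x))
    (hT : IsBoundedOnSchatten p C T) (hp : 1 ≤ p) (hS : CommutesWithSigns p T) :
    IsBoundedOnSchatten p C (amplification T ι) := by
  have htend := fun {Z : L →L[ℂ] L} (hZ : MemSchatten p Z) =>
    hι.tendsto_blockMap hlim hT hp hS hZ
  have hmem : ∀ Z, MemSchatten p Z → MemSchatten p (amplification T ι Z) ∧
      schattenReal p (amplification T ι Z) ≤ C * schattenReal p Z := fun Z hZ =>
    MemSchatten.of_tendsto hp (mul_nonneg C.coe_nonneg (schattenReal_nonneg _))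
      (Eventually.of_forall fun F => ⟨memSchatten_blockMap hT hp F hZ,
        hι.schattenReal_blockMap_le hT hp hS F hZ⟩) (htend hZ)
  refine isBoundedOnSchatten_of_schattenReal hp (fun Z hZ => (hmem Z hZ).1)
    (fun Z W hZ hW => amplification_eq_of_tendsto ?_)
    (fun c Z hZ => amplification_eq_of_tendsto ?_) fun Z hZ => (hmem Z hZ).2
  · simp_rw [blockMap_add hT hp _ hZ hW]
    exact (htend hZ).add (htend hW)
  · simp_rw [blockMap_smul hT hp _ c hZ]
    exact (htend hZ).const_smul c

end OrthogonalCopies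

end InfiniteBlocks

section Tensor

variable {H : Type*} [NormedAddCommGroup H] [InnerProductSpace ℂ H]
  {K : Type*} [NormedAddCommGroup K] [InnerProductSpace ℂ K]
  {p : ℝ≥0∞} {C : ℝ≥0} {T : (H →L[ℂ] H) → (H →L[ℂ] H)} {I : Type*}

/-- The map `x ↦ x ⊗ v` into the Hilbert space tensor product. -/
def tmulRight (H : Type*) [NormedAddCommGroup H] [InnerProductSpace ℂ H] (v : K) :
    H →L[ℂ] HilbertTensor H K :=
  Completion.toComplL ∘L (TensorProduct.mkL ℂ H K).flip v

lemma tmulRight_apply (v : K) (x : H) :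
    tmulRight H v x = ((x ⊗ₜ[ℂ] v : H ⊗[ℂ] K) : HilbertTensor H K) := rfl

lemma hilbertTensor_ext {M N : HilbertTensor H K →L[ℂ] HilbertTensor H K}
    (h : ∀ v x, M (tmulRight H v x) = N (tmulRight H v x)) : M = N := by
  ext z
  induction z using Completion.induction_on with
  | hp => exact isClosed_eq M.continuous N.continuous
  | ih z =>
    induction z using TensorProduct.induction_on with
    | zero => rw [Completion.coe_zero, map_zero, map_zero]
    | tmul x v => exact h v x
    | add z w hz hw => rw [Completion.coe_add, map_add, map_add, hz, hw]

lemma tendsto_of_tendsto_tmulRight {α : Type*} {l : Filter α}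
    {P : α → HilbertTensor H K →L[ℂ] HilbertTensor H K} (hP : ∀ k, ‖P k‖ ≤ 1)
    (h : ∀ v x, Tendsto (fun k => P k (tmulRight H v x)) l (𝓝 (tmulRight H v x)))
    (z : HilbertTensor H K) : Tendsto (fun k => P k z) l (𝓝 z) := by
  have hdense : ∀ y : H ⊗[ℂ] K, Tendsto (fun k => P k y) l (𝓝 (y : HilbertTensor H K)) := by
    intro y
    induction y using TensorProduct.induction_on with
    | zero => simpa only [Completion.coe_zero, map_zero] using tendsto_const_nhds
    | tmul x v => exact h v x
    | add y w hy hw => simpa only [Completion.coe_add, map_add] using hy.add hw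
  rw [Metric.tendsto_nhds]
  intro ε hε
  obtain ⟨y, hy⟩ := (Completion.denseRange_coe (α := H ⊗[ℂ] K)).exists_dist_lt z
    (show 0 < ε / 3 by positivity)
  filter_upwards [(Metric.tendsto_nhds.mp (hdense y)) (ε / 3) (by positivity)] with k hk
  have hcontract : dist (P k z) (P k y) ≤ dist z y := by
    rw [dist_eq_norm, dist_eq_norm, ← map_sub]
    simpa only [one_mul] using (P k).le_of_opNorm_le (hP k) (z - y)
  have htriangle := dist_triangle4_right (P k z) z (P k y) y
  linarith

lemma tensorOp_tmulRight (A : H →L[ℂ] H) (B : K →L[ℂ] K) (v : K) (x : H) :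
    tensorOp A B (tmulRight H v x) = tmulRight H (B v) (A x) := by
  rw [tensorOp, tmulRight_apply, ContinuousLinearMap.completion_apply_coe,
    TensorProduct.mapL_tmul, tmulRight_apply]

lemma norm_tmulRight_le {v : K} (hv : ‖v‖ ≤ 1) : ‖tmulRight H v‖ ≤ 1 := by
  refine ContinuousLinearMap.opNorm_le_bound _ zero_le_one fun x => ?_
  rw [tmulRight_apply, Completion.norm_coe, TensorProduct.norm_tmul, mul_comm]
  gcongr

variable [CompleteSpace H]

lemma adjoint_tmulRight_apply (v w : K) (x : H) :
    adjoint (tmulRight H v) (tmulRight H w x) = (inner ℂ v w : ℂ) • x := by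
  refine ext_inner_left ℂ fun y => ?_
  rw [ContinuousLinearMap.adjoint_inner_right, tmulRight_apply, tmulRight_apply,
    Completion.inner_coe, TensorProduct.inner_tmul, inner_smul_right, mul_comm]

lemma orthogonalCopies_tmulRight {e : I → K} (he : Orthonormal ℂ e) :
    OrthogonalCopies fun i => tmulRight H (e i) where
  adjoint_apply_self i x := by
    rw [adjoint_tmulRight_apply, inner_self_eq_norm_sq_to_K, he.1 i, RCLike.ofReal_one, one_pow,
      one_smul]
  adjoint_apply_of_ne i j hij x := by rw [adjoint_tmulRight_apply, he.2 hij, zero_smul]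

lemma tendsto_copiesProj_tmulRight (e : HilbertBasis I ℂ K) (z : HilbertTensor H K) :
    Tendsto (fun F => copiesProj (fun i => tmulRight H (e i)) F z) atTop (𝓝 z) := by
  have hnorm := fun F =>
    ((orthogonalCopies_tmulRight (H := H) e.orthonormal).isStarProjection_copiesProj F).norm_le
  refine tendsto_of_tendsto_tmulRight hnorm (fun v x => ?_) z
  let J : K →L[ℂ] HilbertTensor H K := Completion.toComplL ∘L TensorProduct.mkL ℂ H K x
  have hJ : ∀ w, J w = tmulRight H w x := fun _ => rfl
  have hsum : HasSum (fun i => J (inner ℂ (e i) v • e i)) (J v) := by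
    simpa only [HilbertBasis.repr_apply_apply] using J.hasSum (e.hasSum_repr v)
  have hlim : Tendsto (fun F : Finset I => ∑ i ∈ F, J (inner ℂ (e i) v • e i)) atTop
      (𝓝 (tmulRight H v x)) := by
    rw [← hJ]
    simpa only [HasSum, SummationFilter.unconditional_filter] using hsum
  refine hlim.congr fun F => ?_
  rw [copiesProj_apply]
  refine Finset.sum_congr rfl fun i _ => ?_
  rw [adjoint_tmulRight_apply, map_smul, map_smul, hJ]

lemma blockMap_tensorOp (hT : IsBoundedOnSchatten p C T) (e : I → K) (F : Finset I)
    {A : H →L[ℂ] H} (hA : MemSchatten p A) (B : K →L[ℂ] K) :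
    blockMap T (fun i => tmulRight H (e i)) F (tensorOp A B) =
      copiesProj (fun i => tmulRight H (e i)) F ∘L tensorOp (T A) B ∘L
        copiesProj (fun i => tmulRight H (e i)) F := by
  have hblock : ∀ (A : H →L[ℂ] H) (i j : I),
      adjoint (tmulRight H (e i)) ∘L tensorOp A B ∘L tmulRight H (e j) =
        (inner ℂ (e i) (B (e j)) : ℂ) • A := fun A i j => by
    ext x
    simp only [ContinuousLinearMap.comp_apply, tensorOp_tmulRight, adjoint_tmulRight_apply,
      smul_apply]
  ext z
  simp only [blockMap, hblock, hT.map_smul _ A hA]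
  simp only [← hblock, sum_apply, ContinuousLinearMap.comp_apply, copiesProj_apply, map_sum]
  exact Finset.sum_comm

lemma tensorOp_rankOne_self (A : H →L[ℂ] H) (v : K) :
    tensorOp A (rankOne ℂ v v) = tmulRight H v ∘L A ∘L adjoint (tmulRight H v) := by
  refine hilbertTensor_ext fun w x => ?_
  rw [tensorOp_tmulRight, ContinuousLinearMap.comp_apply, ContinuousLinearMap.comp_apply,
    adjoint_tmulRight_apply, rankOne_apply, tmulRight_apply, TensorProduct.tmul_smul, map_smul,
    map_smul, tmulRight_apply, Completion.coe_smul]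

lemma tmulRight_conj_tensorOp_rankOne_self (A : H →L[ℂ] H) {v : K} (hv : ‖v‖ = 1) :
    adjoint (tmulRight H v) ∘L tensorOp A (rankOne ℂ v v) ∘L tmulRight H v = A := by
  have hvv : (inner ℂ v v : ℂ) = 1 := by
    rw [inner_self_eq_norm_sq_to_K, hv, RCLike.ofReal_one, one_pow]
  ext x
  rw [ContinuousLinearMap.comp_apply, ContinuousLinearMap.comp_apply, tensorOp_tmulRight,
    rankOne_apply, hvv, one_smul, adjoint_tmulRight_apply, hvv, one_smul]

omit [CompleteSpace H] in
lemma tendsto_conj_apply {L : Type*} [NormedAddCommGroup L] [NormedSpace ℂ L] {α : Type*}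
    {l : Filter α} {P : α → L →L[ℂ] L} (hP : ∀ k, ‖P k‖ ≤ 1)
    (hlim : ∀ z, Tendsto (fun k => P k z) l (𝓝 z)) (A : L →L[ℂ] L) (z : L) :
    Tendsto (fun k => P k (A (P k z))) l (𝓝 (A z)) := by
  have hdiff : Tendsto (fun k => P k (A (P k z - z))) l (𝓝 0) := by
    have hA : Tendsto (fun k => A (P k z - z)) l (𝓝 0) := by
      have := (A.continuous.tendsto _).comp ((hlim z).sub_const z)
      rwa [sub_self, map_zero] at this
    refine squeeze_zero_norm (fun k => ?_) (tendsto_zero_iff_norm_tendsto_zero.mp hA)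
    simpa only [one_mul] using (P k).le_of_opNorm_le (hP k) (A (P k z - z))
  simpa only [map_sub, sub_add_cancel, zero_add] using hdiff.add (hlim (A z))

variable [CompleteSpace K]

lemma CommutesWithSigns.amplificationBounded (hS : CommutesWithSigns p T)
    (hT : IsBoundedOnSchatten p C T) (hp : 1 ≤ p) : AmplificationBounded p C T K := by
  let ι : stdBasisIndex K → H →L[ℂ] HilbertTensor H K := fun i => tmulRight H (stdBasis K i)
  have hι : OrthogonalCopies ι := orthogonalCopies_tmulRight (stdBasis K).orthonormal
  have hlim : ∀ z, Tendsto (fun F => copiesProj ι F z) atTop (𝓝 z) :=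
    tendsto_copiesProj_tmulRight (stdBasis K)
  refine ⟨amplification T ι, hι.isBoundedOnSchatten_amplification hlim hT hp hS,
    fun A B hA _ => amplification_eq fun z => ?_⟩
  simp_rw [ι, blockMap_tensorOp hT (stdBasis K) _ hA B]
  exact tendsto_conj_apply (fun F => (hι.isStarProjection_copiesProj F).norm_le) hlim _ z

lemma AmplificationBounded.schattenReal_le (h : AmplificationBounded p C T K) (hp : 1 ≤ p) {v : K}
    (hv : ‖v‖ = 1) {A : H →L[ℂ] H} (hA : MemSchatten p A) :
    schattenReal p (T A) ≤ C * schattenReal p A := by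
  obtain ⟨S, hS, hST⟩ := h
  let J := tmulRight H v
  let q := rankOne ℂ v v
  have hJ : ‖J‖ ≤ 1 := norm_tmulRight_le hv.le
  have hJ' : ‖adjoint J‖ ≤ 1 := (LinearIsometryEquiv.norm_map adjoint J).trans_le hJ
  have hmem : MemSchatten p (tensorOp A q) := tensorOp_rankOne_self A v ▸ hA.conj hp _ _
  have hSA : S (tensorOp A q) = tensorOp (T A) q := hST A q hA (memSchatten_rankOne hp v v)
  calc schattenReal p (T A)
      = schattenReal p (adjoint J ∘L tensorOp (T A) q ∘L J) := by
        rw [tmulRight_conj_tensorOp_rankOne_self _ hv]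
    _ ≤ 1 * schattenReal p (tensorOp (T A) q) * 1 :=
        schattenReal_conj_le_of_le hp (hSA ▸ hS.mapsTo _ hmem) hJ' hJ
    _ ≤ C * schattenReal p (tensorOp A q) := by
        rw [one_mul, mul_one, ← hSA]
        exact hS.schattenReal_le hp hmem
    _ ≤ C * (1 * schattenReal p A * 1) := by
        rw [tensorOp_rankOne_self]
        gcongr
        exact schattenReal_conj_le_of_le hp hA hJ hJ'
    _ = C * schattenReal p A := by rw [one_mul, mul_one]

end Tensor

section Multiplier

variable {X : Type u} [MeasurableSpace X] {μ : Measure X} [SFinite μ] {p : ℝ≥0∞} {C : ℝ≥0}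
  {φ : X × X → ℂ} {T : (Lp ℂ 2 μ →L[ℂ] Lp ℂ 2 μ) → (Lp ℂ 2 μ →L[ℂ] Lp ℂ 2 μ)}

lemma ExtendsSchur.commutesWithSigns (hE : ExtendsSchur μ p φ T) (hμ : Atomless μ)
    (hφ : MemLp φ ∞ (μ.prod μ)) (hT : IsBoundedOnSchatten p C T) (hp : 1 ≤ p) :
    CommutesWithSigns p T := by
  intro S ε hε
  obtain ⟨D, hD, hDS⟩ := hμ.exists_seq_signMul S hε
  refine ⟨fun n => signMul μ (hD n), ?_, hDS⟩
  exact
    { isSelfAdjoint := fun n => isSelfAdjoint_signMul (hD n)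
      apply_apply := fun n => signMul_signMul (hD n)
      map_conj := fun m n A hA => hT.map_conj_of_rankOne hp (norm_signMul_le (hD m))
        (norm_signMul_le (hD n)) (hE.map_signMul_rankOne hp hφ (hD m) (hD n)) hA }

lemma ExtendsSchur.isBoundedOnSchatten_iff (hE : ExtendsSchur μ p φ T) (hμ : Atomless μ)
    (hφ : MemLp φ ∞ (μ.prod μ)) (hp : 1 ≤ p) :
    IsBoundedOnSchatten p C T ↔ (∃ C' : ℝ≥0, IsBoundedOnSchatten p C' T) ∧
      ∀ (K : Type v) [NormedAddCommGroup K] [InnerProductSpace ℂ K] [CompleteSpace K],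
        AmplificationBounded p C T K := by
  refine ⟨fun hT => ⟨⟨C, hT⟩, fun K _ _ _ =>
    (hE.commutesWithSigns hμ hφ hT hp).amplificationBounded hT hp⟩, fun ⟨⟨_, hT⟩, hK⟩ => ?_⟩
  have hv : ‖EuclideanSpace.single (PUnit.unit : PUnit.{v + 1}) (1 : ℂ)‖ = 1 := by
    rw [PiLp.norm_single, norm_one]
  exact isBoundedOnSchatten_of_schattenReal hp hT.mapsTo hT.map_add hT.map_smul
    fun A hA => (hK (EuclideanSpace ℂ PUnit.{v + 1})).schattenReal_le hp hv hA

end Multiplier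

end SchurMultiplier

end

theorem theorem1p18_general {X : Type u} [MeasurableSpace X] (μ : Measure X) [SFinite μ]
    (hμ : SchurMultiplier.Atomless μ) (φ : X × X → ℂ) (hφ : MemLp φ ∞ (μ.prod μ))
    (p : ℝ≥0∞) (hp : 1 ≤ p) :
    SchurMultiplier.schurNorm μ p φ = SchurMultiplier.schurCbNorm.{u, v} μ p φ := by
  unfold SchurMultiplier.schurNorm SchurMultiplier.schurCbNorm
  refine iInf_congr fun C => iInf_congr_Prop (exists_congr fun T => ?_) fun _ => rfl
  exact and_congr_right fun hE => hE.isBoundedOnSchatten_iff hμ hφ hp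

theorem theorem1p18 {X : Type u} [MeasurableSpace X] (μ : Measure X) [SigmaFinite μ]
    (hμ : SchurMultiplier.Atomless μ) (φ : X × X → ℂ) (hφ : MemLp φ ∞ (μ.prod μ))
    (p : ℝ≥0∞) (hp : 1 ≤ p) :
    SchurMultiplier.schurNorm μ p φ = SchurMultiplier.schurCbNorm.{u, v} μ p φ :=
  theorem1p18_general μ hμ φ hφ p hp
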